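/- Let $\mathbb F$ be a field, let $m,n\ge 0$, and let $A_1,\dots,A_m$ be $n\times n$ matrices over $\mathbb F$ with span $\mathcal A=\operatorname{span}\{A_1,\dots,A_m\}$. Let $D$ be the free skew field over $\mathbb F$ on non-commuting variables $x_1,\dots,x_m$ (the universal skew field of fractions of the free algebra $\mathbb F\langle x_1,\dots,x_m\rangle$): a skew field containing $\mathbb F$ in its centre, generated as a skew field by $\mathbb F$ and $x_1,\dots,x_m$, such that every rational expression (an expression formed from scalars and variables by sums, products and nested inverses) that can be evaluated without inverting zero at some point $(a_1,\dots,a_m)\in K^m$ of some skew field $K$ containing $\mathbb F$ in its centre can also be evaluated at $(x_1,\dots,x_m)$. Such a $D$ exists. The non-commutative rank $\operatorname{ncrk}(\mathcal A)$ is the rank over $D$ of the matrix $A(\underline x)=x_1A_1+\cdots+x_mA_m$. Let $W$ be the representation of the generalized Kronecker quiver (two vertices $x,y$ and $m$ arrows from $x$ to $y$) with $W(x)=W(y)=\mathbb F^n$ and with the maps $A_1,\dots,A_m$, and let $\sigma=(1,-1)$, so that $\sigma(\underline{\dim}\, W')=\dim W'(x)-\dim W'(y)$ for a subrepresentation $W'$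 of $W$. Then $c:=\max_{W'\subseteq W}\sigma(\underline{\dim}\, W')$, the maximum over all subrepresentations $W'$ of $W$, exists, and $$\operatorname{ncrk}(\mathcal A)=n-c .$$ -/

import Mathlib

universe u

/-! ### Non-commutative rational expressions and the free skew field -/

/-- Formal non-commutative rational expressions in variables `x₁, …, x_m` with coefficients in
`F`: built from scalars and variables by sums, products and (possibly nested) inverses. -/
inductive NCRatExpr (F : Type u) (m : ℕ) : Type u
  | const (c : F) : NCRatExpr F m
  | var (i : Fin m) : NCRatExpr F m
  | add (p q : NCRatExpr F m) : NCRatExpr F m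
  | mul (p q : NCRatExpr F m) : NCRatExpr F m
  | inv (p : NCRatExpr F m) : NCRatExpr F m

namespace NCRatExpr

variable {F : Type u} [Field F] {m : ℕ} {K : Type u} [DivisionRing K] [Algebra F K]

/-- The value of a rational expression at a point `a ∈ K^m`; it is meaningful only if the
expression is defined at `a`. -/
def eval (a : Fin m → K) : NCRatExpr F m → K
  | const c => algebraMap F K c
  | var i => a i
  | add p q => eval a p + eval a q
  | mul p q => eval a p * eval a q
  | inv p => (eval a p)⁻¹

/-- A rational expression is defined at `a` if evaluating it at `a` never inverts zero. -/
def DefinedAt (a : Fin m → K) : NCRatExpr F m → Prop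
  | const _ => True
  | var _ => True
  | add p q => DefinedAt a p ∧ DefinedAt a q
  | mul p q => DefinedAt a p ∧ DefinedAt a q
  | inv p => DefinedAt a p ∧ eval a p ≠ 0

end NCRatExpr

/-- `D` is the free skew field over `F` (with `F` central) on `x₁, …, x_m`, that is, the universal
skew field of fractions of the free algebra `F⟨x₁, …, x_m⟩`: it is generated as a skew field by `F`
and the `x_i`, and every specialization `x_i ↦ a_i` into a skew field `K` over `F` is possible as
far as it makes sense, i.e. a rational expression that can be evaluated at some point of some `K`
can be evaluated at `x`.

(The elements `p(x)`, for `p` defined at `a`, form a subring `D₀` of `D`, and `p(x) ↦ p(a)` is then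
a well defined ring homomorphism `D₀ → K` such that every element of `D₀` outside its kernel is
invertible in `D₀`, which is what is called a specialization from `D` to `K`.) -/
structure IsFreeSkewField (F : Type u) [Field F] {m : ℕ} {D : Type u} [DivisionRing D]
    [Algebra F D] (x : Fin m → D) : Prop where
  generates : ∀ z : D, ∃ p : NCRatExpr F m, p.DefinedAt x ∧ p.eval x = z
  universal : ∀ (K : Type u) [DivisionRing K] [Algebra F K] (a : Fin m → K) (p : NCRatExpr F m),
    p.DefinedAt a → p.DefinedAt x

/-- The matrix of linear forms `A(x) = x₁ A₁ + ⋯ + x_m A_m` with entries in `D`. -/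
def linearMatrix {F : Type u} [Field F] {m n : ℕ} {D : Type u} [DivisionRing D] [Algebra F D]
    (A : Fin m → Matrix (Fin n) (Fin n) F) (x : Fin m → D) : Matrix (Fin n) (Fin n) D :=
  fun i j => ∑ k, x k * algebraMap F D (A k i j)

/-- The rank of a matrix over a skew field: the dimension of the left vector space spanned by
its rows (equivalently, of the right vector space spanned by its columns). -/
noncomputable def skewRank {D : Type u} [DivisionRing D] {n : ℕ}
    (M : Matrix (Fin n) (Fin n) D) : ℕ :=
  Module.finrank D (Submodule.span D (Set.range M.row))

/-! ### Quiver representations -/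

/-- A finite dimensional representation over `F` of the quiver `Q`. -/
structure QuiverRep (F : Type u) [Field F] (Q : Type) [Quiver.{0} Q] where
  space : Q → Type u
  [addCommGroup : ∀ v, AddCommGroup (space v)]
  [module : ∀ v, Module F (space v)]
  [finite : ∀ v, FiniteDimensional F (space v)]
  map : ∀ {v w : Q}, (v ⟶ w) → (space v →ₗ[F] space w)

attribute [instance] QuiverRep.addCommGroup QuiverRep.module QuiverRep.finite

/-- A subrepresentation: a subspace at each vertex, preserved by the maps of all arrows. -/
structure QuiverSubrep {F : Type u} [Field F] {Q : Type} [Quiver.{0} Q] (W : QuiverRep F Q) where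
  space : ∀ v, Submodule F (W.space v)
  map_mem : ∀ {v w : Q} (f : v ⟶ w), ∀ z ∈ space v, W.map f z ∈ space w

/-- The dimension vector of a subrepresentation. -/
noncomputable def QuiverSubrep.dimVec {F : Type u} [Field F] {Q : Type} [Quiver.{0} Q]
    {W : QuiverRep F Q} (W' : QuiverSubrep W) : Q → ℕ :=
  fun v => Module.finrank F (W'.space v)

/-- The value `σ(α) = ∑ v, σ(v) α(v)` of a weight on a dimension vector. -/
def quiverWeight {Q : Type} [Fintype Q] (σ : Q → ℤ) (α : Q → ℕ) : ℤ :=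
  ∑ v, σ v * (α v : ℤ)

/-- The vertices of the generalized Kronecker quiver with `m` arrows. -/
inductive KroneckerQuiver (m : ℕ) : Type
  | source : KroneckerQuiver m
  | target : KroneckerQuiver m
  deriving DecidableEq, Fintype

/-- There are exactly `m` arrows from the source to the target, and no others. -/
instance (m : ℕ) : Quiver.{0} (KroneckerQuiver m) where
  Hom
    | .source, .target => Fin m
    | _, _ => Empty

/-- The representation `F^n ⇉ F^n` of the generalized Kronecker quiver with maps
`A₁, …, A_m`. -/
def kroneckerRep {F : Type u} [Field F] {m n : ℕ} (A : Fin m → Matrix (Fin n) (Fin n) F) :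
    QuiverRep F (KroneckerQuiver m) where
  space _ := Fin n → F
  map {v w} := match v, w with
    | .source, .target => fun k : Fin m => (A k).mulVecLin
    | .source, .source => fun e : Empty => e.elim
    | .target, .source => fun e : Empty => e.elim
    | .target, .target => fun e : Empty => e.elim

/-- The weight `σ = (1, -1)`. -/
def kroneckerWeight (m : ℕ) : KroneckerQuiver m → ℤ
  | .source => 1
  | .target => -1

/-! Upper bound: if `U` has dimension `d` and `∑ A_k U` has dimension `e`, then in a basis adapted
to `U` the matrix `A(x)` has `d` columns that factor through `e` dimensions. So its rank is at most
`n - (d - e)` at every point of every skew field (`finrank_add_rowRank_pencil_le`). A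
subrepresentation with source space `U` must contain `∑ A_k U` at the target, so `c` is the largest
possible `d - e`.

Lower bound: it suffices to find one skew field `K`, one point `a` and one `U` with `n - (d - e) ≤
rank A(a)` (`exists_point_and_shrunk_subspace`). Gaussian elimination on `A(a)` uses only rational
expressions defined at `a`. These are also defined at the generic point, so the rank there is at
least as large (`rowRank_pencil_le`).

The point and the subspace come from blow-ups `∑ A_k ⊗ X_k` over an infinite field. A cyclic
division algebra of degree `d` is a form of the `d × d` matrices, so by density the rank of a
blow-up of size `d` is at most `d` times the rank at a point of that algebra, and some blow-up of
size `d` attains at least this multiple (`exists_divisionRing_rank`). The supremum of rank divided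
by size is therefore an integer, attained at some `T`. Maximality over all larger blow-ups keeps the
Wong sequence started at `ker A(T)` inside the range of `A(T)`, and a dimension count gives `U`
(`exists_shrunk_subspace`). General fields are reached by extending to `F(t)` and reducing `U`
modulo `t`.

The same result yields the free skew field. An expression is defined exactly where a certain pencil
is nonsingular (`NCRatExpr.linearization`), a pencil is nonsingular somewhere exactly when it
shrinks no subspace, and that condition passes to direct sums. Hence finitely many expressions, each
defined somewhere, are defined at a common point, and an ultraproduct of such points is generic. -/

set_option linter.unusedSectionVars false

/-! ### Rank of matrices over division rings -/

section Rank

open Matrix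

/-- `M` has rank at least `r`: the identity matrix of size `r` factors through `M`. -/
def HasRankGE {R ι κ : Type*} [Semiring R] [Fintype ι] [Fintype κ] (M : Matrix ι κ R) (r : ℕ) :
    Prop :=
  ∃ (P : Matrix (Fin r) ι R) (Q : Matrix κ (Fin r) R), P * M * Q = 1

/-- The dimension of the left row space. -/
noncomputable def rowRank {D ι κ : Type*} [DivisionRing D] (M : Matrix ι κ D) : ℕ :=
  Module.finrank D (Submodule.span D (Set.range M.row))

variable {D : Type*} [DivisionRing D] {ι κ τ : Type*} [Fintype ι] [Fintype κ] [Fintype τ]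

lemma rowRank_eq_finrank_range (M : Matrix ι κ D) :
    rowRank M = Module.finrank D (LinearMap.range M.vecMulLinear) := by
  rw [range_vecMulLinear, rowRank]

lemma rowRank_mul_le_right (M : Matrix ι κ D) (N : Matrix κ τ D) :
    rowRank (M * N) ≤ rowRank N := by
  rw [rowRank_eq_finrank_range, rowRank_eq_finrank_range]
  apply Submodule.finrank_mono
  rintro _ ⟨v, rfl⟩
  exact ⟨v ᵥ* M, by simp⟩

lemma rowRank_mul_le_left (M : Matrix ι κ D) (N : Matrix κ τ D) :
    rowRank (M * N) ≤ rowRank M := by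
  rw [rowRank_eq_finrank_range, rowRank_eq_finrank_range]
  have : LinearMap.range (M * N).vecMulLinear
      = (LinearMap.range M.vecMulLinear).map N.vecMulLinear := by
    rw [← LinearMap.range_comp]
    congr 1
    ext v
    simp
  rw [this]
  exact Submodule.finrank_map_le _ _

lemma rowRank_le_card_left (M : Matrix ι κ D) : rowRank M ≤ Fintype.card ι := by
  rw [rowRank_eq_finrank_range]
  exact (LinearMap.finrank_range_le _).trans_eq (Module.finrank_fintype_fun_eq_card D)

lemma rowRank_le_card_right (M : Matrix ι κ D) : rowRank M ≤ Fintype.card κ := by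
  rw [rowRank_eq_finrank_range]
  exact (Submodule.finrank_le _).trans_eq (Module.finrank_fintype_fun_eq_card D)

lemma rowRank_one [DecidableEq ι] : rowRank (1 : Matrix ι ι D) = Fintype.card ι := by
  rw [rowRank_eq_finrank_range, LinearMap.range_eq_top.2, finrank_top,
    Module.finrank_fintype_fun_eq_card]
  intro v
  exact ⟨v, by simp⟩

lemma HasRankGE.le_rowRank {M : Matrix ι κ D} {r : ℕ} (h : HasRankGE M r) : r ≤ rowRank M := by
  obtain ⟨P, Q, h⟩ := h
  calc r = rowRank (P * M * Q) := by rw [h, rowRank_one, Fintype.card_fin]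
    _ ≤ rowRank (P * M) := rowRank_mul_le_left _ _
    _ ≤ rowRank M := rowRank_mul_le_right _ _

/-- Rank factorization. -/
lemma exists_rank_factorization (M : Matrix ι κ D) :
    ∃ (P : Matrix ι (Fin (rowRank M)) D) (Q : Matrix (Fin (rowRank M)) κ D),
      M = P * Q ∧ HasRankGE M (rowRank M) := by
  classical
  set W := LinearMap.range M.vecMulLinear with hW
  have hr : Module.finrank D W = rowRank M := (rowRank_eq_finrank_range M).symm
  let b : Module.Basis (Fin (rowRank M)) D W := Module.finBasisOfFinrankEq D W hr
  let Q : Matrix (Fin (rowRank M)) κ D := fun i => (b i : κ → D)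
  have hmem : ∀ i, Pi.single i 1 ᵥ* M ∈ W := fun i => ⟨_, rfl⟩
  let P : Matrix ι (Fin (rowRank M)) D := fun i => b.repr ⟨_, hmem i⟩
  have hQ : ∀ c : Fin (rowRank M) → D, c ᵥ* Q = ((∑ i, c i • b i : W) : κ → D) := by
    intro c
    ext j
    simp [Matrix.vecMul, dotProduct, Q]
  have hPQ : M = P * Q := by
    ext i j
    have h1 : (P * Q) i = P i ᵥ* Q := by
      ext j; rfl
    rw [h1, hQ]
    have := b.sum_repr ⟨_, hmem i⟩
    simp only [P]
    rw [this]
    simp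
  -- The rows of `Q` are combinations of rows of `M`, giving `P' M = Q`; they are also independent,
  -- so `Q` has a right inverse. Together these factor the identity through `M`.
  have hb : ∀ i, ∃ v, v ᵥ* M = Q i := fun i => (b i).2
  choose P' hP' using hb
  have hinj : LinearMap.ker Q.vecMulLinear = ⊥ := by
    rw [LinearMap.ker_eq_bot']
    intro c hc
    have h2 : c ᵥ* Q = 0 := hc
    rw [hQ] at h2
    have h3 : ∑ i, c i • b i = 0 := Subtype.ext h2
    funext i
    exact (Fintype.linearIndependent_iff.1 b.linearIndependent) c h3 i
  obtain ⟨g, hg⟩ := LinearMap.exists_leftInverse_of_injective _ hinj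
  refine ⟨P, Q, hPQ, Matrix.of P', Matrix.of fun j => g (Pi.single j 1), ?_⟩
  have h4 : (Matrix.of P') * M = Q := by
    ext i j
    have : ((Matrix.of P') * M) i = P' i ᵥ* M := by ext; rfl
    rw [this, hP']
  rw [h4]
  have hgv : ∀ v : κ → D, g v = fun i => ∑ j, v j * g (Pi.single j 1) i := by
    intro v
    conv_lhs => rw [← Finset.univ_sum_single v]
    rw [map_sum]
    ext i
    rw [Finset.sum_apply]
    refine Finset.sum_congr rfl fun j _ => ?_
    have : (Pi.single j (v j) : κ → D) = v j • Pi.single j 1 := by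
      rw [← Pi.single_smul]; simp
    rw [this, map_smul]; rfl
  ext i j
  have h5 := congrArg (fun f => f (Pi.single i 1) j) hg
  simp only [LinearMap.comp_apply, LinearMap.id_apply] at h5
  rw [hgv] at h5
  simp only [Matrix.vecMulLinear_apply, single_one_vecMul] at h5
  rw [Matrix.one_apply, Matrix.mul_apply]
  refine h5.trans ?_
  rw [Pi.single_apply]
  simp [eq_comm]

lemma hasRankGE_iff {M : Matrix ι κ D} {r : ℕ} : HasRankGE M r ↔ r ≤ rowRank M := by
  refine ⟨HasRankGE.le_rowRank, fun h => ?_⟩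
  obtain ⟨_, _, _, P, Q, hPQ⟩ := exists_rank_factorization M
  refine ⟨P.submatrix (Fin.castLE h) id, Q.submatrix id (Fin.castLE h), ?_⟩
  have : P.submatrix (Fin.castLE h) id * M * Q.submatrix id (Fin.castLE h)
      = (P * M * Q).submatrix (Fin.castLE h) (Fin.castLE h) := by
    ext i j; simp [Matrix.mul_apply]
  rw [this, hPQ, Matrix.submatrix_one _ (Fin.castLE_injective h)]

lemma le_rowRank_of_mul_eq_one [DecidableEq τ] {M : Matrix ι κ D} {P : Matrix τ ι D}
    {Q : Matrix κ τ D} (h : P * M * Q = 1) : Fintype.card τ ≤ rowRank M := by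
  calc Fintype.card τ = rowRank (P * M * Q) := by rw [h, rowRank_one]
    _ ≤ rowRank (P * M) := rowRank_mul_le_left _ _
    _ ≤ rowRank M := rowRank_mul_le_right _ _

lemma rowRank_mul_le_card (P : Matrix ι τ D) (Q : Matrix τ κ D) :
    rowRank (P * Q) ≤ Fintype.card τ :=
  (rowRank_mul_le_right P Q).trans (rowRank_le_card_left Q)

lemma rowRank_eq_rank {Λ : Type*} [Field Λ] (M : Matrix ι κ Λ) : rowRank M = M.rank :=
  (Matrix.rank_eq_finrank_span_row M).symm

lemma HasRankGE.map {R S : Type*} [Semiring R] [Semiring S] {M : Matrix ι κ R} {r : ℕ}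
    (h : HasRankGE M r) (f : R →+* S) : HasRankGE (M.map f) r := by
  obtain ⟨P, Q, h⟩ := h
  refine ⟨P.map f, Q.map f, ?_⟩
  rw [← Matrix.map_mul, ← Matrix.map_mul, h, Matrix.map_one _ (map_zero f) (map_one f)]

/-- The rank does not change under extensions of division rings. -/
lemma rowRank_map {D' : Type*} [DivisionRing D'] (f : D →+* D') (M : Matrix ι κ D) :
    rowRank (M.map f) = rowRank M := by
  obtain ⟨P, Q, hPQ, h⟩ := exists_rank_factorization M
  -- Both certificates, a factorization through size `r` and a factorization of the identity of size
  -- `r` through `M`, are matrix equations and survive a ring homomorphism.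
  refine le_antisymm ?_ (h.map f).le_rowRank
  have : M.map f = P.map f * Q.map f := by rw [← Matrix.map_mul, ← hPQ]
  rw [this]
  exact (rowRank_mul_le_card _ _).trans_eq (Fintype.card_fin _)

end Rank

/-! ### Linear pencils -/

section Pencil

open Matrix

variable {F : Type*} [Field F] {m : Type*} [Fintype m] {ι κ : Type*} [Fintype ι] [Fintype κ]

/-- The matrix `∑ x_k A_k` with entries in an `F`-algebra. -/
def pencil {R : Type*} [Semiring R] [Algebra F R] (A : m → Matrix ι κ F) (x : m → R) :
    Matrix ι κ R :=
  fun i j => ∑ k, x k * algebraMap F R (A k i j)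

/-- The subspace `∑ A_k U`. -/
def pencilImage (A : m → Matrix ι κ F) (U : Submodule F (κ → F)) : Submodule F (ι → F) :=
  ⨆ k, U.map (A k).mulVecLin

lemma mulVec_mem_pencilImage {A : m → Matrix ι κ F} {U : Submodule F (κ → F)} (k : m)
    {v : κ → F} (hv : v ∈ U) : A k *ᵥ v ∈ pencilImage A U :=
  Submodule.mem_iSup_of_mem k ⟨v, hv, rfl⟩

lemma pencilImage_le {A : m → Matrix ι κ F} {U : Submodule F (κ → F)} {V : Submodule F (ι → F)} :
    pencilImage A U ≤ V ↔ ∀ k, ∀ v ∈ U, A k *ᵥ v ∈ V := by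
  rw [pencilImage, iSup_le_iff]
  exact forall_congr' fun k => Submodule.map_le_iff_le_comap

/-- The columns of `Q` are a basis of `U`, and `Q'` comes from a linear retraction onto `U`. As the
relation `Q' * Q = 1` is a matrix identity, the columns stay independent after mapping the entries
to a skew field. -/
lemma exists_basis_matrix (U : Submodule F (κ → F)) :
    ∃ (Q : Matrix κ (Fin (Module.finrank F U)) F) (Q' : Matrix (Fin (Module.finrank F U)) κ F),
      Q' * Q = 1 ∧ (∀ j, (fun i => Q i j) ∈ U) ∧
      ∀ v ∈ U, ∃ c : Fin (Module.finrank F U) → F, v = Q *ᵥ c := by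
  classical
  let b := Module.finBasis F U
  obtain ⟨g, hg⟩ := LinearMap.exists_leftInverse_of_injective U.subtype U.ker_subtype
  refine ⟨Matrix.of fun i j => (b j : κ → F) i,
    Matrix.of fun j i => b.repr (g (Pi.single i 1)) j, ?_, fun j => (b j).2, ?_⟩
  · ext i j
    have h := congrArg (fun f => b.repr (f (b j)) i) hg
    simp only [LinearMap.comp_apply, LinearMap.id_apply, Submodule.subtype_apply] at h
    conv_lhs at h => rw [← Finset.univ_sum_single (b j : κ → F)]
    simp only [map_sum, Finsupp.coe_finsetSum, Finset.sum_apply, Module.Basis.repr_self] at h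
    rw [Matrix.mul_apply, Matrix.one_apply]
    rw [Finsupp.single_apply] at h
    simp only [eq_comm (a := i)]
    rw [← h]
    refine Finset.sum_congr rfl fun k _ => ?_
    have : (Pi.single k ((b j : κ → F) k) : κ → F) = (b j : κ → F) k • Pi.single k 1 := by
      rw [← Pi.single_smul]; simp
    rw [this, map_smul, map_smul, Finsupp.smul_apply, smul_eq_mul, mul_comm]
    rfl
  · intro v hv
    refine ⟨fun j => b.repr ⟨v, hv⟩ j, ?_⟩
    have := congrArg (Subtype.val) (b.sum_repr ⟨v, hv⟩)
    ext i
    have h2 := congrFun this i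
    simp only [Submodule.coe_sum, Finset.sum_apply, Submodule.coe_smul, Pi.smul_apply,
      smul_eq_mul] at h2
    simp only [Matrix.mulVec, dotProduct]
    rw [← h2]
    exact Finset.sum_congr rfl fun k _ => mul_comm _ _

/-- A shrunk subspace bounds the rank of a pencil at every point of every division ring. -/
theorem finrank_add_rowRank_pencil_le {D : Type*} [DivisionRing D] [Algebra F D]
    (A : m → Matrix ι κ F) (x : m → D) (U : Submodule F (κ → F)) :
    Module.finrank F U + rowRank (pencil A x) ≤
      Fintype.card κ + Module.finrank F (pencilImage A U) := by
  classical
  obtain ⟨Q, Q', hQ, hQU, -⟩ := exists_basis_matrix U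
  obtain ⟨P, -, -, -, hP⟩ := exists_basis_matrix (pencilImage A U)
  have hS : ∀ k j, ∃ c, (A k * Q).col j = P *ᵥ c := by
    intro k j
    refine hP _ ?_
    have : (A k * Q).col j = A k *ᵥ (fun i => Q i j) := by
      ext i; rfl
    rw [this]
    exact mulVec_mem_pencilImage k (hQU j)
  choose S hS using hS
  let f := algebraMap F D
  set QD := Q.map f
  have hQD : Q'.map f * QD = 1 := by
    rw [← Matrix.map_mul, hQ, Matrix.map_one _ (map_zero f) (map_one f)]
  -- The columns of each `A k * Q` lie in the image space spanned by the columns of `P`. The entries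
  -- of `P` are central scalars, so they can be pulled out to the left of the `x k`.
  have key : pencil A x * QD = P.map f * Matrix.of (fun l j => ∑ k, x k * f (S k j l)) := by
    ext i j
    simp only [Matrix.mul_apply, pencil, QD, Matrix.map_apply, Matrix.of_apply, Finset.sum_mul, Finset.mul_sum]
    rw [Finset.sum_comm]
    conv_rhs => rw [Finset.sum_comm]
    refine Finset.sum_congr rfl fun k _ => ?_
    have h := congrFun (hS k j) i
    simp only [Matrix.col_apply, Matrix.mul_apply, Matrix.mulVec, dotProduct] at h
    have h2 := congrArg (fun z => x k * f z) h
    simp only [map_sum, map_mul, Finset.mul_sum] at h2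
    simp only [mul_assoc]
    rw [show (∑ l, x k * (algebraMap F D (A k i l) * f (Q l j)))
      = ∑ l, x k * (f (A k i l) * f (Q l j)) from rfl, h2]
    refine Finset.sum_congr rfl fun l _ => ?_
    rw [← mul_assoc, ← mul_assoc, (Algebra.commutes (P i l) (x k) : f _ * _ = _)]
  have h1 : rowRank (pencil A x * QD) ≤ Module.finrank F (pencilImage A U) := by
    rw [key]
    exact (rowRank_mul_le_card _ _).trans_eq (Fintype.card_fin _)
  have h2 : Module.finrank D (LinearMap.ker QD.vecMulLinear) + Module.finrank F U
      = Fintype.card κ := by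
    have h3 := LinearMap.finrank_range_add_finrank_ker QD.vecMulLinear
    rw [LinearMap.range_eq_top.2, finrank_top, Module.finrank_fintype_fun_eq_card,
      Module.finrank_fintype_fun_eq_card, Fintype.card_fin] at h3
    · omega
    · intro v
      exact ⟨v ᵥ* Q'.map f, by simp [hQD]⟩
  -- Right multiplication by `QD` has kernel of dimension `|κ| - dim U`; restricted to the row space
  -- of `A(x)` it loses at most that much rank.
  set W := LinearMap.range (pencil A x).vecMulLinear
  have h4 := LinearMap.finrank_range_add_finrank_ker (QD.vecMulLinear.domRestrict W)
  have h5 : Module.finrank D (LinearMap.ker (QD.vecMulLinear.domRestrict W)) ≤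
      Module.finrank D (LinearMap.ker QD.vecMulLinear) := by
    have : Submodule.map W.subtype (LinearMap.ker (QD.vecMulLinear.domRestrict W)) ≤
        LinearMap.ker QD.vecMulLinear := by
      rintro _ ⟨v, hv, rfl⟩
      exact hv
    have h6 := Submodule.finrank_mono this
    rwa [Submodule.finrank_map_subtype_eq] at h6
  have h7 : LinearMap.range (QD.vecMulLinear.domRestrict W) =
      LinearMap.range (pencil A x * QD).vecMulLinear := by
    ext v
    constructor
    · rintro ⟨⟨_, w, rfl⟩, rfl⟩
      exact ⟨w, by simp [LinearMap.domRestrict_apply]⟩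
    · rintro ⟨w, rfl⟩
      exact ⟨⟨_, w, rfl⟩, by simp [LinearMap.domRestrict_apply]⟩
  rw [h7, ← rowRank_eq_finrank_range, ← rowRank_eq_finrank_range] at h4
  omega

end Pencil

/-! ### Density -/

section Density

open Matrix MvPolynomial

/-- Over an infinite field `E`, a pencil over an extension `Λ` attains its rank at an `E`-point. -/
theorem exists_rank_le_of_infinite {E Λ σ ι κ : Type*} [Field E] [Infinite E] [Field Λ]
    [Algebra E Λ] [Fintype σ] [Fintype ι] [Fintype κ] (B : σ → Matrix ι κ Λ) (c : σ → Λ) :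
    ∃ e : σ → E, rowRank (∑ s, c s • B s) ≤ rowRank (∑ s, algebraMap E Λ (e s) • B s) := by
  classical
  obtain ⟨_, _, _, P, Q, hPQ⟩ := exists_rank_factorization (∑ s, c s • B s)
  -- A generic determinant, equal to 1 at `c` by the choice of `P` and `Q`. A nonzero polynomial
  -- cannot vanish on the infinite grid of `E`-points, and where it does not vanish the rank is at
  -- least the size of the determinant.
  let p : MvPolynomial σ Λ :=
    det (P.map (C : Λ →+* MvPolynomial σ Λ) * (∑ s, (X s : MvPolynomial σ Λ) • (B s).map (C : Λ →+* MvPolynomial σ Λ)) *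
      Q.map (C : Λ →+* MvPolynomial σ Λ))
  have hp : ∀ x : σ → Λ, eval x p = det (P * (∑ s, x s • B s) * Q) := by
    intro x
    rw [← RingHom.coe_coe, RingHom.map_det]
    congr 1
    ext i j
    simp [Matrix.mul_apply, Matrix.sum_apply]
  have hp0 : p ≠ 0 := by
    intro h
    have := hp c
    rw [h, hPQ] at this
    simp at this
  obtain ⟨e, he⟩ : ∃ e : σ → E, eval (fun s => algebraMap E Λ (e s)) p ≠ 0 := by
    by_contra! h
    apply hp0
    refine MvPolynomial.funext_set (fun _ => Set.range (algebraMap E Λ))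
      (fun _ => Set.infinite_range_of_injective (algebraMap E Λ).injective) ?_
    intro x hx
    have hx' : ∀ s, ∃ e, algebraMap E Λ e = x s := fun s => hx s trivial
    choose e he using hx'
    rw [map_zero, ← h e]
    congr 2
    funext s
    exact (he s).symm
  refine ⟨e, ?_⟩
  rw [hp] at he
  set N := P * (∑ s, algebraMap E Λ (e s) • B s) * Q with hN
  refine HasRankGE.le_rowRank ⟨N⁻¹ * P, Q, ?_⟩
  rw [Matrix.mul_assoc, Matrix.mul_assoc, ← Matrix.mul_assoc P, ← hN]
  exact Matrix.nonsing_inv_mul _ (isUnit_iff_ne_zero.2 he)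

end Density

/-! ### Cyclic division algebras of arbitrary degree -/

section Twist

variable {B : Type*} [CommRing B] {k : ℕ}

/-- The `s`-semilinear operator `e_j ↦ e_{j+1}`, `e_k ↦ w e_0`. -/
def twist (s : B →+* B) (w : B) (f : Fin (k + 1) → B) : Fin (k + 1) → B :=
  Fin.cons (w * s (f (Fin.last k))) fun j : Fin k => s (f j.castSucc)

@[simp] lemma twist_zero_apply (s : B →+* B) (w : B) (f : Fin (k + 1) → B) :
    twist s w f 0 = w * s (f (Fin.last k)) := rfl

@[simp] lemma twist_succ (s : B →+* B) (w : B) (f : Fin (k + 1) → B) (j : Fin k) :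
    twist s w f j.succ = s (f j.castSucc) := rfl

lemma twist_add (s : B →+* B) (w : B) (f g : Fin (k + 1) → B) :
    twist s w (f + g) = twist s w f + twist s w g := by
  ext j
  refine Fin.cases ?_ (fun j => ?_) j <;> simp [mul_add]

lemma twist_smul (s : B →+* B) (w c : B) (f : Fin (k + 1) → B) :
    twist s w (c • f) = s c • twist s w f := by
  ext j
  refine Fin.cases ?_ (fun j => ?_) j <;> simp [mul_left_comm]

lemma twist_zero (s : B →+* B) (w : B) : twist s w (0 : Fin (k + 1) → B) = 0 := by
  ext j
  refine Fin.cases ?_ (fun j => ?_) j <;> simp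

lemma twist_map {B' : Type*} [CommRing B'] (a : B →+* B') (s : B →+* B) (s' : B' →+* B') (w : B)
    (h : ∀ b, a (s b) = s' (a b)) (f : Fin (k + 1) → B) :
    twist s' (a w) (fun j => a (f j)) = fun j => a (twist s w f j) := by
  ext j
  refine Fin.cases ?_ (fun j => ?_) j <;> simp [h]

/-- The matrices commuting with `twist σ w`. -/
def twistCentralizer (E : Type*) {Λ : Type*} [Field E] [Field Λ] [Algebra E Λ] (σ : Λ ≃ₐ[E] Λ)
    (w : Λ) (k : ℕ) : Subalgebra E (Matrix (Fin (k + 1)) (Fin (k + 1)) Λ) where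
  carrier := {X | ∀ f, X.mulVec (twist (σ : Λ →+* Λ) w f) = twist (σ : Λ →+* Λ) w (X.mulVec f)}
  mul_mem' {X Y} hX hY f := by
    rw [← Matrix.mulVec_mulVec, hY, hX, Matrix.mulVec_mulVec]
  add_mem' {X Y} hX hY f := by
    rw [Matrix.add_mulVec, hX, hY, Matrix.add_mulVec, twist_add]
  algebraMap_mem' c f := by
    have h : ∀ f : Fin (k + 1) → Λ, (algebraMap E (Matrix (Fin (k + 1)) (Fin (k + 1)) Λ) c).mulVec f
        = algebraMap E Λ c • f := by
      intro f
      ext i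
      simp [Matrix.algebraMap_eq_diagonal, Matrix.mulVec_diagonal]
    rw [h, h, twist_smul]
    simp

end Twist

/-! ### The division property, by comparing degrees modulo `k + 1`. -/

section Degrees

open Polynomial

variable {B : Type*} [CommRing B] [IsDomain B] {k : ℕ}

/-- The nonzero terms have degrees in distinct residue classes modulo `k + 1`, so their leading
terms cannot cancel. -/
lemma eq_zero_of_sum_eq_zero_of_natDegree_mod {g : Fin (k + 1) → B[X]} {c : ℕ}
    (h : ∀ j, g j ≠ 0 → (g j).natDegree % (k + 1) = (j + c) % (k + 1)) (h0 : ∑ j, g j = 0)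
    (j : Fin (k + 1)) : g j = 0 := by
  have h1 := degree_sum_eq_of_disjoint g Finset.univ ?_
  · rw [h0, degree_zero, eq_comm, Finset.sup_eq_bot_iff] at h1
    exact degree_eq_bot.1 (h1 j (Finset.mem_univ j))
  · rintro i ⟨-, hi⟩ j ⟨-, hj⟩ hij hd
    apply hij
    have h2 : (g i).natDegree = (g j).natDegree := natDegree_eq_of_degree_eq hd
    have h3 := h i hi
    rw [h2, h j hj] at h3
    have h4 : (j : ℕ) ≡ i [MOD k + 1] := Nat.ModEq.add_right_cancel' c h3
    rw [Nat.ModEq, Nat.mod_eq_of_lt i.2, Nat.mod_eq_of_lt j.2] at h4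
    exact Fin.ext h4.symm

/-- Interleave the polynomials `f_j` into a single one. -/
noncomputable def interleave (f : Fin (k + 1) → B[X]) : B[X] :=
  ∑ j : Fin (k + 1), X ^ (j : ℕ) * expand B (k + 1) (f j)

lemma interleave_eq_zero {f : Fin (k + 1) → B[X]} (h : interleave f = 0) : f = 0 := by
  ext1 j
  have h1 := eq_zero_of_sum_eq_zero_of_natDegree_mod (c := 0) ?_ h j
  · simpa [expand_eq_zero] using h1
  · intro j hj
    rw [natDegree_mul (by simp) (right_ne_zero_of_mul hj), natDegree_expand, natDegree_X_pow]
    simp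

/-- Multiplication by `X` moves the component in degrees `≡ j` to `j + 1`; at the wrap-around the
extra `X ^ (k + 1)` is the image of `w = X` under `expand`. Thus the twist becomes "apply `s`, then
multiply by `X`" on single polynomials. -/
lemma interleave_twist (s : B →+* B) (f : Fin (k + 1) → B[X]) :
    interleave (twist (mapRingHom s) X f) = X * (interleave f).map s := by
  rw [interleave, Fin.sum_univ_succ, interleave, Fin.sum_univ_castSucc, Polynomial.map_add,
    Polynomial.map_sum, mul_add, Finset.mul_sum, add_comm]
  congr 1
  · refine Finset.sum_congr rfl fun j _ => ?_
    simp only [twist_succ, Fin.val_succ, Fin.val_castSucc, Polynomial.map_mul,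
      Polynomial.map_pow, map_X, map_expand, coe_mapRingHom]
    ring
  · simp only [twist_zero_apply, Fin.val_last, Polynomial.map_mul, Polynomial.map_pow, map_X,
      map_expand, coe_mapRingHom, map_mul, expand_X, Fin.val_zero]
    ring

lemma interleave_iterate_twist (s : B →+* B) (f : Fin (k + 1) → B[X]) (i : ℕ) :
    interleave ((twist (mapRingHom s) X)^[i] f) = X ^ i * (mapRingHom s)^[i] (interleave f) := by
  induction i with
  | zero => simp
  | succ i ih =>
    rw [Function.iterate_succ_apply', Function.iterate_succ_apply', interleave_twist, ih]
    simp only [coe_mapRingHom, Polynomial.map_mul, Polynomial.map_pow, map_X]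
    ring

/-- The orbit of a nonzero vector under the twist is linearly independent. -/
lemma det_iterate_twist_ne_zero (s : B →+* B) (hs : Function.Injective s)
    {f : Fin (k + 1) → B[X]} (hf : f ≠ 0) :
    (Matrix.of fun j i : Fin (k + 1) => (twist (mapRingHom s) X)^[i] f j).det ≠ 0 := by
  intro hdet
  obtain ⟨c, hc, h0⟩ := Matrix.exists_mulVec_eq_zero_iff.2 hdet
  apply hc
  have h1 : ∑ i : Fin (k + 1), c i • (twist (mapRingHom s) X)^[i] f = 0 := by
    ext1 j
    have := congrFun h0 j
    simp only [Matrix.mulVec, dotProduct, Matrix.of_apply, Pi.zero_apply] at this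
    rw [Finset.sum_apply, Pi.zero_apply, ← this]
    exact Finset.sum_congr rfl fun i _ => mul_comm _ _
  have h2 : interleave (∑ i : Fin (k + 1), c i • (twist (mapRingHom s) X)^[i] f) =
      ∑ i : Fin (k + 1), expand B (k + 1) (c i) * interleave ((twist (mapRingHom s) X)^[i] f) := by
    simp only [interleave, Finset.sum_apply, map_sum, Finset.mul_sum]
    rw [Finset.sum_comm]
    refine Finset.sum_congr rfl fun i _ => Finset.sum_congr rfl fun j _ => ?_
    simp only [Pi.smul_apply, smul_eq_mul, map_mul]
    ring
  rw [h1] at h2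
  have hI : interleave f ≠ 0 := fun h => hf (interleave_eq_zero h)
  have hinj : Function.Injective (mapRingHom s) := Polynomial.map_injective s hs
  have hn : ∀ i : ℕ, ((mapRingHom s)^[i] (interleave f)).natDegree = (interleave f).natDegree := by
    intro i
    induction i with
    | zero => rfl
    | succ i ih =>
      rw [Function.iterate_succ_apply', ← ih]
      exact natDegree_map_eq_of_injective hs _
  have hne : ∀ i : ℕ, (mapRingHom s)^[i] (interleave f) ≠ 0 := by
    intro i h
    induction i with
    | zero => exact hI h
    | succ i ih =>
      rw [Function.iterate_succ_apply'] at h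
      exact ih (hinj (h.trans (map_zero _).symm))
  -- The `i`-th term has degree congruent to `i + deg (interleave f)`: `expand` contributes a
  -- multiple of `k + 1`, the iterate contributes `X ^ i`, and the injective `s` preserves degrees.
  have h3 : ∀ i, expand B (k + 1) (c i) * interleave ((twist (mapRingHom s) X)^[i] f) = 0 := by
    apply eq_zero_of_sum_eq_zero_of_natDegree_mod (c := (interleave f).natDegree)
    · intro i hi
      rw [natDegree_mul (left_ne_zero_of_mul hi) (right_ne_zero_of_mul hi),
        interleave_iterate_twist, natDegree_mul (by simp) (hne i), natDegree_expand, hn,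
        natDegree_X_pow, Nat.mul_add_mod']
    · rw [← h2]
      simp [interleave]
  ext1 i
  have h4 := h3 i
  rw [interleave_iterate_twist] at h4
  have h5 := (mul_eq_zero.1 h4).resolve_right (mul_ne_zero (by simp) (hne i))
  simpa [expand_eq_zero] using h5

/-- Nonzero matrices in the centralizer of the twist are invertible. -/
lemma det_ne_zero_of_mem_twistCentralizer {E Λ : Type*} [Field E] [Field Λ] [Algebra E Λ]
    [Algebra B[X] Λ] [IsFractionRing B[X] Λ] (s : B →+* B) (hs : Function.Injective s)
    (σ : Λ ≃ₐ[E] Λ) (hσ : ∀ b, σ (algebraMap B[X] Λ b) = algebraMap B[X] Λ (mapRingHom s b))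
    {Y : Matrix (Fin (k + 1)) (Fin (k + 1)) Λ}
    (hY : Y ∈ twistCentralizer E σ (algebraMap B[X] Λ X) k) (hY0 : Y ≠ 0) : Y.det ≠ 0 := by
  intro hdet
  apply hY0
  obtain ⟨v, hv, h0⟩ := Matrix.exists_mulVec_eq_zero_iff.2 hdet
  obtain ⟨b, hb⟩ := IsLocalization.exist_integer_multiples_of_finite (nonZeroDivisors B[X]) v
  choose f hf using hb
  let a := algebraMap B[X] Λ
  have ha : Function.Injective a := IsFractionRing.injective B[X] Λ
  have hb0 : a b ≠ 0 := fun h => nonZeroDivisors.ne_zero b.2 (ha (h.trans (map_zero a).symm))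
  have hf' : (fun j => a (f j)) = a b • v := by
    ext j
    rw [show a (f j) = _ from hf j, Algebra.smul_def]
    rfl
  have hf0 : f ≠ 0 := by
    rintro rfl
    apply hv
    have : a b • v = 0 := by rw [← hf']; ext; simp
    exact (smul_eq_zero.1 this).resolve_left hb0
  -- Since `Y` commutes with the twist, its kernel is stable under it. One nonzero kernel vector,
  -- with denominators cleared, therefore produces `k + 1` independent ones, and `Y` vanishes.
  have hker : ∀ i : ℕ, Y.mulVec (fun j => a ((twist (mapRingHom s) X)^[i] f j)) = 0 := by
    intro i
    induction i with
    | zero => rw [Function.iterate_zero, id, hf', Matrix.mulVec_smul, h0, smul_zero]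
    | succ i ih =>
      rw [Function.iterate_succ_apply', ← twist_map a (mapRingHom s) (σ : Λ →+* Λ) X
        (fun b => (hσ b).symm), hY, ih, twist_zero]
  have hdet' := det_iterate_twist_ne_zero s hs hf0
  set Φ := Matrix.of fun j i : Fin (k + 1) => (twist (mapRingHom s) X)^[i] f j with hΦ
  have hYΦ : Y * Φ.map a = 0 := by
    ext j i
    exact congrFun (hker i) j
  have hu : IsUnit (Φ.map a).det := by
    rw [isUnit_iff_ne_zero, ← RingHom.mapMatrix_apply, ← RingHom.map_det]
    exact fun h => hdet' (ha (h.trans (map_zero a).symm))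
  calc Y = Y * (Φ.map a * (Φ.map a)⁻¹) := by rw [Matrix.mul_nonsing_inv _ hu, mul_one]
    _ = 0 := by rw [← Matrix.mul_assoc, hYΦ, Matrix.zero_mul]

end Degrees

/-! ### The centralizer is a form of the full matrix algebra. -/

section Span

variable {E Λ : Type*} [Field E] [Field Λ] [Algebra E Λ] {σ : Λ ≃ₐ[E] Λ} {w : Λ} {k : ℕ}

lemma inv_mem_twistCentralizer {Y : Matrix (Fin (k + 1)) (Fin (k + 1)) Λ}
    (hY : Y ∈ twistCentralizer E σ w k) (hdet : Y.det ≠ 0) : Y⁻¹ ∈ twistCentralizer E σ w k := by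
  intro f
  have hu : IsUnit Y.det := isUnit_iff_ne_zero.2 hdet
  have h : f = Y.mulVec (Y⁻¹.mulVec f) := by
    rw [Matrix.mulVec_mulVec, Matrix.mul_nonsing_inv _ hu, Matrix.one_mulVec]
  conv_lhs => rw [h, ← hY, Matrix.mulVec_mulVec, Matrix.nonsing_inv_mul _ hu, Matrix.one_mulVec]

/-- This is the copy of `Λ` in the cyclic algebra. The order of `σ` matters only at the wrap-around
entry. -/
lemma diagonal_mem_twistCentralizer (hσ : σ ^ (k + 1) = 1) (l : Λ) :
    Matrix.diagonal (fun j : Fin (k + 1) => (σ ^ (j : ℕ)) l) ∈ twistCentralizer E σ w k := by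
  intro f
  ext j
  refine Fin.cases ?_ (fun j => ?_) j
  · have h : σ ((σ ^ k) l) = l := by
      rw [← AlgEquiv.mul_apply, ← pow_succ', hσ]; rfl
    simp only [Matrix.mulVec_diagonal, twist_zero_apply, Fin.val_zero, pow_zero,
      AlgEquiv.one_apply, map_mul, Fin.val_last, RingHom.coe_coe, h]
    ring
  · simp only [Matrix.mulVec_diagonal, twist_succ, Fin.val_succ, map_mul, Fin.val_castSucc,
      RingHom.coe_coe, pow_succ', AlgEquiv.mul_apply]

/-- The linear twist. -/
def shiftMatrix (w : Λ) (k : ℕ) : Matrix (Fin (k + 1)) (Fin (k + 1)) Λ :=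
  LinearMap.toMatrix'
    { toFun := twist (RingHom.id Λ) w
      map_add' := twist_add _ _
      map_smul' := fun c f => twist_smul _ _ c f }

lemma shiftMatrix_mulVec (f : Fin (k + 1) → Λ) :
    (shiftMatrix w k).mulVec f = twist (RingHom.id Λ) w f := by
  rw [shiftMatrix, LinearMap.toMatrix'_mulVec]; rfl

lemma shiftMatrix_mem_twistCentralizer (hw : σ w = w) :
    shiftMatrix w k ∈ twistCentralizer E σ w k := by
  intro f
  rw [shiftMatrix_mulVec, shiftMatrix_mulVec]
  have h : ∀ j, twist (σ : Λ →+* Λ) w f j = σ (twist (RingHom.id Λ) w f j) := by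
    intro j
    refine Fin.cases ?_ (fun j => ?_) j <;> simp [hw]
  ext j
  refine Fin.cases ?_ (fun j => ?_) j <;> simp [h]

lemma shiftMatrix_succ_castSucc (j : Fin k) : shiftMatrix w k j.succ j.castSucc = 1 := by
  have := congrFun (shiftMatrix_mulVec (w := w) (Pi.single j.castSucc 1)) j.succ
  simpa using this

lemma shiftMatrix_zero_last : shiftMatrix w k 0 (Fin.last k) = w := by
  have := congrFun (shiftMatrix_mulVec (w := w) (Pi.single (Fin.last k) 1)) 0
  simpa using this

/-- The centralizer of the twist spans the full matrix algebra over `Λ`. -/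
theorem span_twistCentralizer_eq_top (hσ : σ ^ (k + 1) = 1)
    (hinj : Function.Injective fun j : Fin (k + 1) => σ ^ (j : ℕ)) (hw : σ w = w) (hw0 : w ≠ 0) :
    Submodule.span Λ (twistCentralizer E σ w k : Set (Matrix (Fin (k + 1)) (Fin (k + 1)) Λ)) = ⊤ := by
  classical
  let K := twistCentralizer E σ w k
  let S := Algebra.adjoin Λ (K : Set (Matrix (Fin (k + 1)) (Fin (k + 1)) Λ))
  have hcl : Submonoid.closure (K : Set (Matrix (Fin (k + 1)) (Fin (k + 1)) Λ)) =
      K.toSubmonoid := Submonoid.closure_eq K.toSubmonoid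
  have hS : Subalgebra.toSubmodule S =
      Submodule.span Λ (K : Set (Matrix (Fin (k + 1)) (Fin (k + 1)) Λ)) := by
    rw [Algebra.adjoin_eq_span, hcl]; rfl
  have hKS : ∀ Y ∈ K, Y ∈ S := fun Y hY => Algebra.subset_adjoin hY
  have hdiag : ∀ d : Fin (k + 1) → Λ, Matrix.diagonal d ∈ S := by
    -- Dedekind's independence of characters: a functional vanishing on all vectors `(σ ^ j l)_j` is
    -- a linear relation between the distinct automorphisms `σ ^ j`.
    have htop : Submodule.span Λ (Set.range fun l : Λ => fun j : Fin (k + 1) => (σ ^ (j : ℕ)) l)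
        = ⊤ := by
      by_contra hne
      obtain ⟨g, hg0, hg⟩ := Submodule.exists_le_ker_of_lt_top _ (lt_top_iff_ne_top.2 hne)
      apply hg0
      have hli : LinearIndependent Λ
          (fun j : Fin (k + 1) => (((σ ^ (j : ℕ) : Λ ≃ₐ[E] Λ) : Λ →* Λ) : Λ → Λ)) := by
        refine (linearIndependent_monoidHom Λ Λ).comp
          (fun j : Fin (k + 1) => ((σ ^ (j : ℕ) : Λ ≃ₐ[E] Λ) : Λ →* Λ)) ?_
        intro i j hij
        apply hinj
        ext l
        exact DFunLike.congr_fun hij l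
      have hz := Fintype.linearIndependent_iff.1 hli (fun j => g (Pi.single j 1)) ?_
      · refine LinearMap.pi_ext' fun j => LinearMap.ext_ring ?_
        simpa using hz j
      · ext l
        have h1 : g (fun j : Fin (k + 1) => (σ ^ (j : ℕ)) l) = 0 := hg (Submodule.subset_span ⟨l, rfl⟩)
        rw [← Finset.univ_sum_single (fun j : Fin (k + 1) => (σ ^ (j : ℕ)) l), map_sum] at h1
        rw [Finset.sum_apply, Pi.zero_apply, ← h1]
        refine Finset.sum_congr rfl fun j _ => ?_
        have : (Pi.single j ((σ ^ (j : ℕ)) l) : Fin (k + 1) → Λ) = (σ ^ (j : ℕ)) l • Pi.single j 1 := by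
          rw [← Pi.single_smul]; simp
        rw [this, map_smul]
        exact mul_comm _ _
    have hle : Submodule.span Λ (Set.range fun l : Λ => fun j : Fin (k + 1) => (σ ^ (j : ℕ)) l) ≤
        (Subalgebra.toSubmodule S).comap (Matrix.diagonalLinearMap (Fin (k + 1)) Λ Λ) := by
      rw [Submodule.span_le]
      rintro _ ⟨l, rfl⟩
      exact hKS _ (diagonal_mem_twistCentralizer hσ l)
    rw [htop] at hle
    exact fun d => hle (Submodule.mem_top : d ∈ ⊤)
  -- Diagonal idempotents cut single entries out of the shift. Its nonzero entries form one directed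
  -- cycle through all indices, so products of them reach every matrix unit.
  have hsingle : ∀ i j, Matrix.single i j (shiftMatrix w k i j) ∈ S := by
    intro i j
    have h : Matrix.single i j (shiftMatrix w k i j) =
        Matrix.diagonal (Pi.single i 1) * shiftMatrix w k * Matrix.diagonal (Pi.single j 1) := by
      ext a b
      rw [Matrix.mul_diagonal, Matrix.diagonal_mul, Matrix.single_apply, Pi.single_apply,
        Pi.single_apply]
      grind
    rw [h]
    exact S.mul_mem (S.mul_mem (hdiag _) (hKS _ (shiftMatrix_mem_twistCentralizer hw))) (hdiag _)
  have htrans : ∀ i j l, Matrix.single i j (1 : Λ) ∈ S → Matrix.single j l (1 : Λ) ∈ S →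
      Matrix.single i l (1 : Λ) ∈ S := by
    intro i j l h1 h2
    have := S.mul_mem h1 h2
    rwa [Matrix.single_mul_single_same, one_mul] at this
  have hrefl : ∀ i, Matrix.single i i (1 : Λ) ∈ S := by
    intro i
    rw [← Matrix.diagonal_single]
    exact hdiag _
  have hsucc : ∀ j : Fin k, Matrix.single j.succ j.castSucc (1 : Λ) ∈ S := by
    intro j
    have := hsingle j.succ j.castSucc
    rwa [shiftMatrix_succ_castSucc] at this
  have hlast : Matrix.single 0 (Fin.last k) (1 : Λ) ∈ S := by
    have := S.smul_mem (hsingle 0 (Fin.last k)) w⁻¹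
    rwa [shiftMatrix_zero_last, Matrix.smul_single, smul_eq_mul, inv_mul_cancel₀ hw0] at this
  have hi0 : ∀ i : Fin (k + 1), Matrix.single i 0 (1 : Λ) ∈ S := by
    intro i
    induction i using Fin.induction with
    | zero => exact hrefl 0
    | succ i ih => exact htrans _ _ _ (hsucc i) ih
  have hlj : ∀ j : Fin (k + 1), Matrix.single (Fin.last k) j (1 : Λ) ∈ S := by
    intro j
    induction j using Fin.reverseInduction with
    | last => exact hrefl _
    | cast j ih => exact htrans _ _ _ ih (hsucc j)
  rw [← hS, eq_top_iff]
  intro T _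
  rw [Matrix.matrix_eq_sum_single T]
  refine Submodule.sum_mem _ fun i _ => Submodule.sum_mem _ fun j _ => ?_
  have h := htrans _ _ _ (htrans _ _ _ (hi0 i) hlast) (hlj j)
  have h' := S.smul_mem h (T i j)
  rwa [Matrix.smul_single, smul_eq_mul, mul_one] at h'

end Span

section CyclicAlgebra

open Polynomial

/-- Every field `E` is central in a division algebra which is a form of a matrix algebra of
given degree over an extension field of `E`. -/
theorem exists_divisionAlgebra_form (E : Type u) [Field E] (k : ℕ) :
    ∃ (Λ : Type u) (_ : Field Λ) (_ : Algebra E Λ)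
      (K : Subalgebra E (Matrix (Fin (k + 1)) (Fin (k + 1)) Λ)),
      (∀ Y ∈ K, Y ≠ 0 → ∃ Z ∈ K, Y * Z = 1 ∧ Z * Y = 1) ∧
      Submodule.span Λ (K : Set (Matrix (Fin (k + 1)) (Fin (k + 1)) Λ)) = ⊤ := by
  classical
  -- The automorphism rotates the `k + 1` variables of `B` and fixes `X`, which serves as `w`. Its
  -- powers are told apart by the image of the variable of index 0.
  let B := MvPolynomial (Fin (k + 1)) E
  let Λ := FractionRing B[X]
  let s : B ≃ₐ[E] B := MvPolynomial.renameEquiv E (Equiv.addRight (1 : Fin (k + 1)))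
  let t : B[X] ≃ₐ[E] B[X] := Polynomial.mapAlgEquiv s
  let σ : Λ ≃ₐ[E] Λ := IsFractionRing.algEquivOfAlgEquiv t
  let a := algebraMap B[X] Λ
  have ha : Function.Injective a := IsFractionRing.injective B[X] Λ
  have hσ : ∀ b, σ (a b) = a (mapRingHom (s : B →+* B) b) := fun b =>
    IsFractionRing.algEquivOfAlgEquiv_algebraMap t b
  have hw : σ (a X) = a X := by rw [hσ]; simp
  have hw0 : a X ≠ 0 := fun h => X_ne_zero (ha (h.trans (map_zero a).symm))
  have hs : ∀ (j : ℕ) (i : Fin (k + 1)),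
      (σ ^ j) (a (C (MvPolynomial.X i))) = a (C (MvPolynomial.X (i + j • 1))) := by
    intro j i
    induction j with
    | zero => simp
    | succ j ih =>
      rw [pow_succ', AlgEquiv.mul_apply, ih, hσ]
      congr 1
      simp only [coe_mapRingHom, map_C, RingHom.coe_coe]
      congr 1
      rw [succ_nsmul, ← add_assoc]
      exact MvPolynomial.rename_X _ _
  have hord : σ ^ (k + 1) = 1 := by
    have h1 : ((σ ^ (k + 1) : Λ ≃ₐ[E] Λ) : Λ →+* Λ) = RingHom.id Λ := by
      refine IsLocalization.ringHom_ext (nonZeroDivisors B[X]) ?_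
      refine Polynomial.ringHom_ext' ?_ ?_
      · refine MvPolynomial.ringHom_ext ?_ ?_
        · intro c
          have : (algebraMap B[X] Λ) (C (MvPolynomial.C c)) = algebraMap E Λ c := by
            rw [IsScalarTower.algebraMap_apply E B[X] Λ]; rfl
          change (σ ^ (k + 1)) ((algebraMap B[X] Λ) (C (MvPolynomial.C c))) =
            (algebraMap B[X] Λ) (C (MvPolynomial.C c))
          rw [this, AlgEquiv.commutes]
        · intro i
          have h2 := hs (k + 1) i
          have h3 : (k + 1) • (1 : Fin (k + 1)) = 0 := by
            simpa using card_nsmul_eq_zero (x := (1 : Fin (k + 1)))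
          rwa [h3, add_zero] at h2
      · have : ∀ j : ℕ, (σ ^ j) (a X) = a X := by
          intro j
          induction j with
          | zero => rfl
          | succ j ih => rw [pow_succ', AlgEquiv.mul_apply, ih, hw]
        exact this (k + 1)
    ext l
    exact RingHom.congr_fun h1 l
  have hinj : Function.Injective fun j : Fin (k + 1) => σ ^ (j : ℕ) := by
    intro i j hij
    have h1 : (σ ^ (i : ℕ)) (a (C (MvPolynomial.X 0))) = (σ ^ (j : ℕ)) (a (C (MvPolynomial.X 0))) :=
      DFunLike.congr_fun hij _
    rw [hs, hs] at h1
    have h2 := MvPolynomial.X_injective (R := E) (C_injective (ha h1))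
    have h3 : ∀ j : ℕ, (j • (1 : Fin (k + 1))).val = j % (k + 1) := by
      intro j
      induction j with
      | zero => simp
      | succ j ih => rw [succ_nsmul, Fin.val_add, ih, Fin.val_one', ← Nat.add_mod]
    have h4 := congrArg Fin.val (add_left_cancel h2)
    rw [h3, h3, Nat.mod_eq_of_lt i.2, Nat.mod_eq_of_lt j.2] at h4
    exact Fin.ext h4
  refine ⟨Λ, inferInstance, inferInstance, twistCentralizer E σ (a X) k, fun Y hY hY0 => ?_,
    span_twistCentralizer_eq_top hord hinj hw hw0⟩
  have hdet := det_ne_zero_of_mem_twistCentralizer (s : B →+* B) s.injective σ hσ hY hY0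
  exact ⟨Y⁻¹, inv_mem_twistCentralizer hY hdet,
    Matrix.mul_nonsing_inv _ (isUnit_iff_ne_zero.2 hdet),
    Matrix.nonsing_inv_mul _ (isUnit_iff_ne_zero.2 hdet)⟩

end CyclicAlgebra

/-! ### Blow-ups of pencils -/

section Blowup

open Matrix

section Flatten

variable {R : Type*} [CommRing R] {ι κ μ τ : Type*} [Fintype ι] [Fintype κ] [Fintype μ] [Fintype τ]

/-- A matrix with matrix entries as a block matrix. -/
def flatten (M : Matrix ι κ (Matrix τ τ R)) : Matrix (ι × τ) (κ × τ) R :=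
  fun p q => M p.1 q.1 p.2 q.2

lemma flatten_mul (M : Matrix ι κ (Matrix τ τ R)) (N : Matrix κ μ (Matrix τ τ R)) :
    flatten (M * N) = flatten M * flatten N := by
  ext p q
  simp [flatten, Matrix.mul_apply, Fintype.sum_prod_type, Matrix.sum_apply]

lemma flatten_one [DecidableEq ι] [DecidableEq τ] :
    flatten (1 : Matrix ι ι (Matrix τ τ R)) = 1 := by
  ext ⟨i, a⟩ ⟨j, b⟩
  by_cases h : i = j
  · subst h
    by_cases h' : a = b
    · subst h'; simp [flatten]
    · simp [flatten, h']
  · simp [flatten, h]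

/-- Restriction of scalars from a division ring inside a matrix ring multiplies the rank. -/
lemma rowRank_flatten_map {K Λ : Type*} [DivisionRing K] [Field Λ] [DecidableEq τ]
    (f : K →+* Matrix τ τ Λ) (M : Matrix ι κ K) :
    rowRank (flatten (M.map f)) = rowRank M * Fintype.card τ := by
  obtain ⟨P, Q, hPQ, P', Q', h⟩ := exists_rank_factorization M
  apply le_antisymm
  · have : flatten (M.map f) = flatten (P.map f) * flatten (Q.map f) := by
      rw [← flatten_mul, ← Matrix.map_mul, ← hPQ]
    rw [this]
    exact (rowRank_mul_le_card _ _).trans_eq (by simp)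
  · have : flatten (P'.map f) * flatten (M.map f) * flatten (Q'.map f) = 1 := by
      rw [← flatten_mul, ← flatten_mul, ← Matrix.map_mul, ← Matrix.map_mul, h,
        Matrix.map_one _ (map_zero f) (map_one f), flatten_one]
    exact le_of_eq_of_le (by simp) (le_rowRank_of_mul_eq_one this)

end Flatten

variable {E : Type*} [Field E] {m ι κ τ : Type*} [Fintype m] [Fintype ι] [Fintype κ] [Fintype τ]

/-- The matrix `∑ A_k ⊗ X_k`. -/
def blowup {Λ : Type*} [Field Λ] [Algebra E Λ] (A : m → Matrix ι κ E) (X : m → Matrix τ τ Λ) :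
    Matrix (ι × τ) (κ × τ) Λ :=
  fun p q => ∑ k, X k p.2 q.2 * algebraMap E Λ (A k p.1 q.1)

lemma blowup_apply {Λ : Type*} [Field Λ] [Algebra E Λ] (A : m → Matrix ι κ E)
    (X : m → Matrix τ τ Λ) (p q) :
    blowup A X p q = ∑ k, X k p.2 q.2 * algebraMap E Λ (A k p.1 q.1) := rfl

lemma flatten_pencil [DecidableEq τ] {Λ : Type*} [Field Λ] [Algebra E Λ] (A : m → Matrix ι κ E)
    (X : m → Matrix τ τ Λ) : flatten (pencil A X) = blowup A X := by
  ext p q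
  simp [flatten, pencil, blowup, Matrix.sum_apply, Matrix.algebraMap_eq_diagonal]

lemma map_blowup {Λ : Type*} [Field Λ] [Algebra E Λ] (A : m → Matrix ι κ E)
    (X : m → Matrix τ τ E) :
    (blowup A X).map (algebraMap E Λ) = blowup A fun k => (X k).map (algebraMap E Λ) := by
  ext p q
  simp [blowup]

lemma map_pencil {R S : Type*} [Semiring R] [Semiring S] [Algebra E R] [Algebra E S]
    (f : R →ₐ[E] S) (A : m → Matrix ι κ E) (x : m → R) :
    (pencil A x).map f = pencil A fun k => f (x k) := by
  ext i j
  simp [pencil]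

end Blowup

/-- Ranks of blow-ups are governed by ranks at points of division rings. -/
theorem exists_divisionRing_rank {E : Type u} [Field E] [Infinite E] {m ι κ : Type*} [Fintype m]
    [Fintype ι] [Fintype κ] (A : m → Matrix ι κ E) {k : ℕ}
    (X : m → Matrix (Fin (k + 1)) (Fin (k + 1)) E) :
    ∃ (K : Type u) (_ : DivisionRing K) (_ : Algebra E K) (a : m → K)
      (X' : m → Matrix (Fin (k + 1)) (Fin (k + 1)) E),
      rowRank (blowup A X) ≤ rowRank (pencil A a) * (k + 1) ∧
      rowRank (pencil A a) * (k + 1) ≤ rowRank (blowup A X') := by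
  classical
  obtain ⟨Λ, _, _, K, hK, hspan⟩ := exists_divisionAlgebra_form E k
  let _ : DivisionRing K := DivisionRing.ofIsUnitOrEqZero fun Y => by
    by_cases hY : Y = 0
    · exact Or.inr hY
    · obtain ⟨Z, hZ, h1, h2⟩ := hK Y Y.2 fun h => hY (Subtype.ext h)
      exact Or.inl ⟨⟨Y, ⟨Z, hZ⟩, Subtype.ext h1, Subtype.ext h2⟩, rfl⟩
  -- Over `Λ` each `X c` is a combination of elements of `K`. Specializing the coefficients to `E`
  -- gives a point `a` of `K` without lowering the rank of the blow-up.
  have hmem : ∀ c, ∃ (n : ℕ) (f : Fin n → Λ) (g : Fin n → K),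
      ∑ i, f i • (g i : Matrix (Fin (k + 1)) (Fin (k + 1)) Λ) = (X c).map (algebraMap E Λ) := by
    intro c
    have : (X c).map (algebraMap E Λ) ∈
        Submodule.span Λ (K : Set (Matrix (Fin (k + 1)) (Fin (k + 1)) Λ)) := by
      rw [hspan]; trivial
    exact Submodule.mem_span_set'.1 this
  choose n f g hfg using hmem
  obtain ⟨e, he⟩ := exists_rank_le_of_infinite (E := E)
    (fun s : Σ c, Fin (n c) => (Matrix.of fun p q =>
      (g s.1 s.2 : Matrix (Fin (k + 1)) (Fin (k + 1)) Λ) p.2 q.2 * algebraMap E Λ (A s.1 p.1 q.1) :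
      Matrix (ι × Fin (k + 1)) (κ × Fin (k + 1)) Λ))
    (fun s => f s.1 s.2)
  let a : m → K := fun c => ∑ i, e ⟨c, i⟩ • g c i
  have hrank := rowRank_flatten_map (K.val : K →+* Matrix (Fin (k + 1)) (Fin (k + 1)) Λ) (pencil A a)
  have hflat : flatten ((pencil A a).map (K.val : K →+* Matrix (Fin (k + 1)) (Fin (k + 1)) Λ)) =
      blowup A fun c => (a c : Matrix (Fin (k + 1)) (Fin (k + 1)) Λ) := by
    rw [← flatten_pencil]
    exact congrArg flatten (map_pencil K.val A a)
  rw [hflat, Fintype.card_fin] at hrank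
  -- In the other direction, the `Λ`-entries of the matrices `a c` are specialized to `E`, one
  -- coefficient for each matrix unit.
  obtain ⟨e', he'⟩ := exists_rank_le_of_infinite (E := E)
    (fun s : m × Fin (k + 1) × Fin (k + 1) => (Matrix.of fun p q =>
      if p.2 = s.2.1 ∧ q.2 = s.2.2 then algebraMap E Λ (A s.1 p.1 q.1) else 0 :
      Matrix (ι × Fin (k + 1)) (κ × Fin (k + 1)) Λ))
    (fun s => (a s.1 : Matrix (Fin (k + 1)) (Fin (k + 1)) Λ) s.2.1 s.2.2)
  refine ⟨K, inferInstance, inferInstance, a, fun c => Matrix.of fun x y => e' (c, x, y), ?_, ?_⟩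
  · rw [← hrank, ← rowRank_map (algebraMap E Λ), map_blowup]
    convert! he using 2
    · ext p q
      simp only [blowup_apply, ← hfg, Matrix.sum_apply, Matrix.smul_apply, Matrix.of_apply, Fintype.sum_sigma,
        Finset.sum_mul, smul_eq_mul, mul_assoc]
    · ext p q
      simp only [blowup_apply, a, Matrix.sum_apply, Matrix.smul_apply, Matrix.of_apply, Fintype.sum_sigma,
        smul_eq_mul, AddSubmonoidClass.coe_finsetSum, Finset.sum_mul]
      refine Finset.sum_congr rfl fun c _ => Finset.sum_congr rfl fun i _ => ?_
      rw [← mul_assoc]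
      congr 1
      exact Algebra.smul_def _ _
  · rw [← hrank]
    refine le_of_le_of_eq (le_of_eq_of_le ?_ he') ?_
    · congr 1
      ext p q
      simp only [blowup_apply, Matrix.sum_apply, Matrix.smul_apply, Matrix.of_apply, Fintype.sum_prod_type,
        smul_eq_mul, mul_ite, mul_zero, ite_and]
      simp
    · rw [← rowRank_map (algebraMap E Λ)]
      congr 1
      ext p q
      simp only [blowup_apply, Matrix.sum_apply, Matrix.smul_apply, Matrix.of_apply, Fintype.sum_prod_type,
        smul_eq_mul, mul_ite, mul_zero, ite_and, Matrix.map_apply]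
      simp

/-! ### Shrunk subspaces from pencils of maximal rank -/

section Bidiagonal

variable {E V W : Type*} [Field E] [AddCommGroup V] [Module E V] [FiniteDimensional E V]
  [AddCommGroup W] [Module E W]

/-- The block bidiagonal map with `M` on the diagonal and `B_j` below the diagonal. -/
def bidiagonal (M : V →ₗ[E] W) {s : ℕ} (B : Fin s → V →ₗ[E] W) :
    (Fin (s + 1) → V) →ₗ[E] (Fin (s + 1) → W) :=
  LinearMap.pi (Fin.cons (M ∘ₗ LinearMap.proj (φ := fun _ => V) 0) fun j : Fin s =>
    M ∘ₗ LinearMap.proj (φ := fun _ => V) j.succ +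
      B j ∘ₗ LinearMap.proj (φ := fun _ => V) j.castSucc)

/-- If the kernel of a block bidiagonal map has maximal dimension, every element of the kernel of
`M` starts a chain. -/
lemma exists_chain_of_finrank_ker (M : V →ₗ[E] W) (G : W →ₗ[E] V)
    (hG : ∀ y ∈ LinearMap.range M, M (G y) = y) {s : ℕ} (B : Fin s → V →ₗ[E] W)
    (h : (s + 1) * Module.finrank E (LinearMap.ker M) ≤
      Module.finrank E (LinearMap.ker (bidiagonal M B)))
    {u : V} (hu : M u = 0) :
    ∃ v : Fin (s + 1) → V, bidiagonal M B v = 0 ∧ v 0 = u ∧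
      ∀ j : Fin s, v j.succ = - G (B j (v j.castSucc)) := by
  -- On the kernel, `B j v_j = -M v_{j+1}` lies in the range of `M`, so `v_{j+1} + G (B j v_j)` is
  -- killed by `M`. This embeds the kernel in `(ker M)^(s+1)`; the dimension hypothesis makes the
  -- embedding onto, and the preimage of `(u, 0, …, 0)` is the chain.
  let Φ₀ : (Fin (s + 1) → V) →ₗ[E] (Fin (s + 1) → V) :=
    LinearMap.pi (Fin.cons (LinearMap.proj (φ := fun _ => V) 0) fun j : Fin s =>
      LinearMap.proj (φ := fun _ => V) j.succ +
        G ∘ₗ B j ∘ₗ LinearMap.proj (φ := fun _ => V) j.castSucc)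
  have hΦ0 : ∀ v, Φ₀ v 0 = v 0 := fun _ => rfl
  have hΦs : ∀ v (j : Fin s), Φ₀ v j.succ = v j.succ + G (B j (v j.castSucc)) := fun _ _ => rfl
  have hker : ∀ v : LinearMap.ker (bidiagonal M B), ∀ j, M (Φ₀ v j) = 0 := by
    rintro ⟨v, hv⟩ j
    have hv' : bidiagonal M B v = 0 := hv
    refine Fin.cases ?_ (fun j => ?_) j
    · exact congrFun hv' 0
    · have h1 : M (v j.succ) + B j (v j.castSucc) = 0 := congrFun hv' j.succ
      have h2 : B j (v j.castSucc) = M (- v j.succ) := by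
        rw [map_neg]; exact eq_neg_of_add_eq_zero_right h1
      rw [hΦs, map_add, hG _ ⟨_, h2.symm⟩, h1]
  let Φ : LinearMap.ker (bidiagonal M B) →ₗ[E] (Fin (s + 1) → LinearMap.ker M) :=
    LinearMap.pi fun j => LinearMap.codRestrict _
      (LinearMap.proj (φ := fun _ => V) j ∘ₗ Φ₀ ∘ₗ (LinearMap.ker (bidiagonal M B)).subtype) fun v => hker v j
  have hinj : Function.Injective Φ := by
    rw [injective_iff_map_eq_zero]
    rintro ⟨v, hv⟩ h0
    have h0' : ∀ j, Φ₀ v j = 0 := fun j => congrArg Subtype.val (congrFun h0 j)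
    apply Subtype.ext
    ext1 j
    change v j = 0
    induction j using Fin.induction with
    | zero => exact h0' 0
    | succ j ih =>
      have := h0' j.succ
      rwa [hΦs, ih, map_zero, map_zero, add_zero] at this
  have hdim : Module.finrank E (LinearMap.ker (bidiagonal M B)) =
      Module.finrank E (Fin (s + 1) → LinearMap.ker M) := by
    refine le_antisymm (LinearMap.finrank_le_finrank_of_injective hinj) ?_
    rw [Module.finrank_pi_fintype]
    simpa using h
  have hsurj : Function.Surjective Φ :=
    (LinearMap.injective_iff_surjective_of_finrank_eq_finrank hdim).1 hinj
  obtain ⟨⟨v, hv⟩, hvu⟩ := hsurj (Pi.single 0 ⟨u, hu⟩)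
  have h1 : ∀ j, Φ₀ v j = ((Pi.single 0 ⟨u, hu⟩ : Fin (s + 1) → LinearMap.ker M) j : V) :=
    fun j => congrArg Subtype.val (congrFun hvu j)
  refine ⟨v, hv, ?_, fun j => ?_⟩
  · have := h1 0
    rwa [Pi.single_eq_same] at this
  · have := h1 j.succ
    rw [Pi.single_eq_of_ne (Fin.succ_ne_zero j), hΦs] at this
    exact eq_neg_of_add_eq_zero_left this

end Bidiagonal

/-! ### The Wong sequence of a pencil of maximal normalized rank. -/

section Wong

open Matrix

variable {E : Type*} [Field E] {m ι κ τ : Type*} [Fintype m] [Fintype ι] [Fintype κ] [Fintype τ]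

lemma blowup_add (A : m → Matrix ι κ E) (X Y : m → Matrix τ τ E) :
    blowup A (X + Y) = blowup A X + blowup A Y := by
  ext p q
  simp [blowup, add_mul, Finset.sum_add_distrib]

lemma blowup_zero (A : m → Matrix ι κ E) : blowup A (0 : m → Matrix τ τ E) = 0 := by
  ext p q
  simp [blowup]

/-- The action of a blow-up by block matrices, block by block. -/
lemma blowup_block_mulVec (A : m → Matrix ι κ E) {s : Type*} [Fintype s]
    (Z : s → s → m → Matrix τ τ E) (f : κ × (s × τ) → E) (i : ι) (j : s) (x : τ) :
    (blowup A (fun k => Matrix.of fun a b : s × τ => Z a.1 b.1 k a.2 b.2) *ᵥ f) (i, (j, x)) =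
      ∑ j', (blowup A (Z j j') *ᵥ fun p => f (p.1, (j', p.2))) (i, x) := by
  simp only [Matrix.mulVec, dotProduct, blowup, Fintype.sum_prod_type, Matrix.of_apply]
  rw [Finset.sum_comm]

lemma rowRank_add_finrank_ker (M : Matrix ι κ E) :
    rowRank M + Module.finrank E (LinearMap.ker M.mulVecLin) = Fintype.card κ := by
  rw [rowRank_eq_rank, Matrix.rank, LinearMap.finrank_range_add_finrank_ker,
    Module.finrank_fintype_fun_eq_card]

/-- Words in the operators `-G A(X)`. -/
def wongWord {V W : Type*} [AddCommGroup V] [Module E V] [AddCommGroup W] [Module E W]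
    (G : W →ₗ[E] V) (B : ℕ → V →ₗ[E] W) (u : V) : ℕ → V
  | 0 => u
  | k + 1 => - G (B k (wongWord G B u k))

lemma wongWord_congr {V W : Type*} [AddCommGroup V] [Module E V] [AddCommGroup W] [Module E W]
    (G : W →ₗ[E] V) {B B' : ℕ → V →ₗ[E] W} (u : V) {k : ℕ} (h : ∀ i < k, B i = B' i) :
    wongWord G B u k = wongWord G B' u k := by
  induction k with
  | zero => rfl
  | succ k ih => rw [wongWord, wongWord, ih fun i hi => h i (by omega), h k (by omega)]

/-- If no blow-up has larger normalized rank than `A(T)`, then words stay in the range. -/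
lemma apply_wongWord_mem_range (A : m → Matrix ι κ E) (T : m → Matrix τ τ E)
    (hmax : ∀ (s : ℕ) (X : m → Matrix (Fin (s + 1) × τ) (Fin (s + 1) × τ) E),
      rowRank (blowup A X) ≤ (s + 1) * rowRank (blowup A T))
    (G : (ι × τ → E) →ₗ[E] (κ × τ → E))
    (hG : ∀ y ∈ LinearMap.range (blowup A T).mulVecLin, (blowup A T).mulVecLin (G y) = y)
    (X : ℕ → m → Matrix τ τ E) {u : κ × τ → E} (hu : (blowup A T).mulVecLin u = 0) (k : ℕ) :
    (blowup A (X k)).mulVecLin (wongWord G (fun i => (blowup A (X i)).mulVecLin) u k) ∈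
      LinearMap.range (blowup A T).mulVecLin := by
  classical
  -- One block row more than the length of the word: the last row reads `M v_{k+1} + B_k v_k = 0`
  -- and puts `B_k v_k` in the range of `M`.
  let s := k + 1
  -- Blocks with `T` on the diagonal and `X j` below it. The blow-up at this point is the bidiagonal
  -- map after reordering coordinates, and the bound on its rank makes its kernel as large as the
  -- chain lemma requires.
  let Z : Fin (s + 1) → Fin (s + 1) → m → Matrix τ τ E :=
    Fin.cons (fun j' => if j' = 0 then T else 0) fun j : Fin s => fun j' =>
      (if j' = j.succ then T else 0) + (if j' = j.castSucc then X j else 0)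
  let Y := blowup A (fun k => Matrix.of fun a b : Fin (s + 1) × τ => Z a.1 b.1 k a.2 b.2)
  set M := (blowup A T).mulVecLin with hM
  let e : (κ × (Fin (s + 1) × τ) → E) ≃ₗ[E] (Fin (s + 1) → κ × τ → E) :=
    { toFun := fun f j p => f (p.1, (j, p.2))
      invFun := fun g q => g q.2.1 (q.1, q.2.2)
      map_add' := fun _ _ => rfl
      map_smul' := fun _ _ => rfl
      left_inv := fun _ => rfl
      right_inv := fun _ => rfl }
  let B : Fin s → (κ × τ → E) →ₗ[E] (ι × τ → E) := fun j => (blowup A (X j)).mulVecLin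
  have hY : ∀ f i j x, (Y *ᵥ f) (i, (j, x)) = bidiagonal M B (e f) j (i, x) := by
    intro f i j x
    rw [blowup_block_mulVec]
    refine Fin.cases ?_ (fun j => ?_) j
    · rw [Finset.sum_eq_single 0]
      · rfl
      · intro j' _ hj'
        simp only [Z, Fin.cons_zero, if_neg hj', blowup_zero, Matrix.zero_mulVec, Pi.zero_apply]
      · simp
    · have hZ : ∀ j', blowup A (Z j.succ j') = (if j' = j.succ then blowup A T else 0) +
          (if j' = j.castSucc then blowup A (X j) else 0) := by
        intro j'
        simp only [Z, Fin.cons_succ, blowup_add]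
        split_ifs <;> simp [blowup_zero]
      simp only [hZ, Matrix.add_mulVec, Pi.add_apply, Finset.sum_add_distrib]
      rw [Finset.sum_eq_single j.succ, Finset.sum_eq_single j.castSucc, if_pos rfl, if_pos rfl]
      · rfl
      · intro j' _ hj'; simp [hj']
      · simp
      · intro j' _ hj'; simp [hj']
      · simp
  have hker : (s + 1) * Module.finrank E (LinearMap.ker M) ≤
      Module.finrank E (LinearMap.ker (bidiagonal M B)) := by
    have h1 : Module.finrank E (LinearMap.ker Y.mulVecLin) ≤
        Module.finrank E (LinearMap.ker (bidiagonal M B)) := by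
      rw [← LinearEquiv.finrank_map_eq e]
      apply Submodule.finrank_mono
      rintro _ ⟨f, hf, rfl⟩
      have hf' : Y *ᵥ f = 0 := hf
      change bidiagonal M B (e f) = 0
      ext j ⟨i, x⟩
      rw [← hY, hf']
      rfl
    have h2 := rowRank_add_finrank_ker Y
    have h3 := rowRank_add_finrank_ker (blowup A T)
    have h4 : rowRank Y ≤ (s + 1) * rowRank (blowup A T) := hmax s _
    simp only [Fintype.card_prod, Fintype.card_fin] at h2 h3
    have h5 : (s + 1) * (rowRank (blowup A T) + Module.finrank E (LinearMap.ker M)) =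
      (s + 1) * (Fintype.card κ * Fintype.card τ) := by rw [h3]
    rw [mul_left_comm] at h2
    rw [mul_add] at h5
    omega
  obtain ⟨v, hv, hv0, hvs⟩ := exists_chain_of_finrank_ker M G hG B hker hu
  have hword : ∀ j : Fin (s + 1),
      v j = wongWord G (fun i => (blowup A (X i)).mulVecLin) u j := by
    intro j
    induction j using Fin.induction with
    | zero => exact hv0
    | succ j ih => rw [hvs, ih]; rfl
  have hlast : M (v (Fin.last k).succ) + B (Fin.last k) (v (Fin.last k).castSucc) = 0 :=
    congrFun hv (Fin.last k).succ
  rw [hword (Fin.last k).castSucc] at hlast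
  refine ⟨- v (Fin.last k).succ, ?_⟩
  rw [map_neg]
  exact (eq_neg_of_add_eq_zero_right hlast).symm

/-- If no blow-up of `A` has larger normalized rank than `A(T)`, there is a subspace shrunk by as
much as the normalized corank of `A(T)`. -/
theorem exists_shrunk_subspace (A : m → Matrix ι κ E) (T : m → Matrix τ τ E)
    (hmax : ∀ (s : ℕ) (X : m → Matrix (Fin (s + 1) × τ) (Fin (s + 1) × τ) E),
      rowRank (blowup A X) ≤ (s + 1) * rowRank (blowup A T)) :
    ∃ U : Submodule E (κ → E),
      Fintype.card κ * Fintype.card τ + Fintype.card τ * Module.finrank E (pencilImage A U) ≤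
        Fintype.card τ * Module.finrank E U + rowRank (blowup A T) := by
  classical
  set M := (blowup A T).mulVecLin with hM
  obtain ⟨g, hg⟩ := M.rangeRestrict.exists_rightInverse_of_surjective M.range_rangeRestrict
  obtain ⟨G, hGg⟩ := LinearMap.exists_extend g
  have hG : ∀ y ∈ LinearMap.range M, M (G y) = y := by
    intro y hy
    have h1 : G y = g ⟨y, hy⟩ := LinearMap.congr_fun hGg ⟨y, hy⟩
    have h2 := LinearMap.congr_fun hg ⟨y, hy⟩
    rw [h1]
    exact congrArg Subtype.val h2
  let L : (m → Matrix τ τ E) → (κ × τ → E) →ₗ[E] (ι × τ → E) := fun X => (blowup A X).mulVecLin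
  -- The span of all words: it contains `ker M` and is stable under `G ∘ L X` for every `X`.
  let S : Submodule E (κ × τ → E) := Submodule.span E
    {w | ∃ (X : ℕ → m → Matrix τ τ E) (u : κ × τ → E) (k : ℕ), M u = 0 ∧
      w = wongWord G (fun i => L (X i)) u k}
  have hkerS : LinearMap.ker M ≤ S := fun u hu => Submodule.subset_span ⟨fun _ => 0, u, 0, hu, rfl⟩
  have hGS : ∀ X, S ≤ (S.comap G).comap (L X) := by
    intro X
    rw [Submodule.span_le]
    rintro _ ⟨X', u, k, hu, rfl⟩
    rw [SetLike.mem_coe, Submodule.mem_comap, Submodule.mem_comap, ← S.neg_mem_iff]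
    -- A word of length `k` depends only on its first `k` letters, so letter `k` is free to be `X`.
    refine Submodule.subset_span ⟨fun i => if i < k then X' i else X, u, k + 1, hu, ?_⟩
    rw [wongWord]
    simp only [if_neg (lt_irrefl k)]
    congr 3
    apply wongWord_congr
    intro i hi
    simp only [if_pos hi]
  have hrange : ∀ X, S ≤ (LinearMap.range M).comap (L X) := by
    intro X
    rw [Submodule.span_le]
    rintro _ ⟨X', u, k, hu, rfl⟩
    have h := apply_wongWord_mem_range A T hmax G hG (fun i => if i < k then X' i else X) hu k
    rw [if_neg (lt_irrefl k)] at h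
    rw [SetLike.mem_coe, Submodule.mem_comap]
    convert! h using 2
    apply wongWord_congr
    intro i hi
    simp only [if_pos hi]; rfl
  let N : Submodule E (ι × τ → E) := ⨆ X, S.map (L X)
  have hNM : N ≤ LinearMap.range M := iSup_le fun X => Submodule.map_le_iff_le_comap.2 (hrange X)
  have hNG : N ≤ S.comap G := iSup_le fun X => Submodule.map_le_iff_le_comap.2 (hGS X)
  have hLN : ∀ X, ∀ w ∈ S, L X w ∈ N := fun X w hw => Submodule.mem_iSup_of_mem X ⟨w, hw, rfl⟩
  -- Since `N` lies in the range of `M` and `G` maps it into `S`, the image of `S` under `M`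
  -- contains `N`; moreover `S` contains `ker M`.
  have hdim1 : Module.finrank E N + Module.finrank E (LinearMap.ker M) ≤ Module.finrank E S := by
    rw [← LinearMap.finrank_range_add_finrank_ker (M.domRestrict S)]
    apply add_le_add
    · apply Submodule.finrank_mono
      intro y hy
      exact ⟨⟨G y, hNG hy⟩, hG y (hNM hy)⟩
    · rw [← Submodule.finrank_map_subtype_eq S]
      apply Submodule.finrank_mono
      intro u hu
      exact ⟨⟨u, hkerS hu⟩, hu, rfl⟩
  -- All slices of vectors of `S`, so that `S` embeds in `U^τ`.
  let U : Submodule E (κ → E) := Submodule.span E {z | ∃ w ∈ S, ∃ y, z = fun c => w (c, y)}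
  have hdim2 : Module.finrank E S ≤ Fintype.card τ * Module.finrank E U := by
    let f : S →ₗ[E] (τ → U) :=
      { toFun := fun w y => ⟨fun c => w.1 (c, y), Submodule.subset_span ⟨w, w.2, y, rfl⟩⟩
        map_add' := fun _ _ => rfl
        map_smul' := fun _ _ => rfl }
    have hf : Function.Injective f := by
      intro w w' h
      ext ⟨c, y⟩
      exact congrFun (congrArg Subtype.val (congrFun h y)) c
    refine (LinearMap.finrank_le_finrank_of_injective hf).trans_eq ?_
    rw [Module.finrank_pi_fintype]
    simp
  let inc : τ → (ι → E) →ₗ[E] (ι × τ → E) := fun y =>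
    { toFun := fun z p => if p.2 = y then z p.1 else 0
      map_add' := fun z z' => by ext p; simp only [Pi.add_apply]; split_ifs <;> simp
      map_smul' := fun c z => by ext p; simp }
  have hinc : ∀ y, pencilImage A U ≤ N.comap (inc y) := by
    intro y
    rw [pencilImage_le]
    intro k
    change U ≤ (N.comap (inc y)).comap (A k).mulVecLin
    rw [Submodule.span_le]
    rintro _ ⟨w, hw, y', rfl⟩
    rw [SetLike.mem_coe, Submodule.mem_comap, Submodule.mem_comap]
    -- Blowing up at the matrix unit `(y, y')` in the variable `k` applies `A k` to slice `y'` and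
    -- places the result in slice `y`. Hence `N` contains `(∑ A_k U)^τ`.
    have : inc y ((A k).mulVecLin fun c => w (c, y')) = L (Pi.single k (Matrix.single y y' 1)) w := by
      ext ⟨i, x⟩
      simp only [inc, LinearMap.coe_mk, AddHom.coe_mk, L, Matrix.mulVecLin_apply, Matrix.mulVec,
        dotProduct, blowup, Fintype.sum_prod_type]
      have h1 : ∀ c x', (∑ k', (Pi.single k (Matrix.single y y' (1 : E)) : m → Matrix τ τ E) k' x x' *
          (algebraMap E E) (A k' i c)) = if x = y ∧ x' = y' then A k i c else 0 := by
        intro c x'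
        rw [Finset.sum_eq_single k]
        · simp [Matrix.single_apply, eq_comm]
        · intro k' _ hk'
          simp [hk']
        · simp
      simp only [h1]
      by_cases hx : x = y <;> simp [hx]
    rw [this]
    exact hLN _ _ hw
  have hdim3 : Fintype.card τ * Module.finrank E (pencilImage A U) ≤ Module.finrank E N := by
    have hmem : ∀ v : τ → pencilImage A U, (fun p : ι × τ => (v p.2 : ι → E) p.1) ∈ N := by
      intro v
      have : (fun p : ι × τ => (v p.2 : ι → E) p.1) = ∑ y, inc y (v y) := by
        ext p
        simp [inc, Finset.sum_apply]
      rw [this]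
      exact N.sum_mem fun y _ => hinc y (v y).2
    let f : (τ → pencilImage A U) →ₗ[E] N :=
      { toFun := fun v => ⟨_, hmem v⟩
        map_add' := fun _ _ => rfl
        map_smul' := fun _ _ => rfl }
    have hf : Function.Injective f := by
      intro v v' h
      ext y i
      exact congrFun (congrArg Subtype.val h) (i, y)
    refine le_of_eq_of_le ?_ (LinearMap.finrank_le_finrank_of_injective hf)
    rw [Module.finrank_pi_fintype]
    simp
  have hdim4 : rowRank (blowup A T) + Module.finrank E (LinearMap.ker M) = _ :=
    rowRank_add_finrank_ker (blowup A T)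
  rw [Fintype.card_prod] at hdim4
  exact ⟨U, by omega⟩

end Wong

/-! ### Integrality of the maximal normalized rank. -/

section MaximalRank

lemma rowRank_blowup_reindex {E : Type*} [Field E] {m ι κ τ τ' : Type*} [Fintype m] [Fintype ι]
    [Fintype κ] [Fintype τ] [Fintype τ'] (A : m → Matrix ι κ E) (X : m → Matrix τ τ E)
    (e : τ' ≃ τ) : rowRank (blowup A fun k => (X k).submatrix e e) = rowRank (blowup A X) := by
  rw [rowRank_eq_rank, rowRank_eq_rank,
    ← Matrix.rank_submatrix (blowup A X) ((Equiv.refl ι).prodCongr e) ((Equiv.refl κ).prodCongr e)]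
  rfl

/-- Over an infinite field, the corank of a pencil at a suitable point of a division ring is at most
the amount by which some subspace is shrunk. -/
theorem exists_point_and_shrunk_subspace_of_infinite {E : Type u} [Field E] [Infinite E]
    {m ι κ : Type*} [Fintype m] [Fintype ι] [Fintype κ] (A : m → Matrix ι κ E) :
    ∃ (K : Type u) (_ : DivisionRing K) (_ : Algebra E K) (a : m → K) (U : Submodule E (κ → E)),
      Fintype.card κ + Module.finrank E (pencilImage A U) ≤
        Module.finrank E U + rowRank (pencil A a) := by
  classical
  let Q : ℕ → Prop := fun r => ∃ (k : ℕ) (X : m → Matrix (Fin (k + 1)) (Fin (k + 1)) E),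
    r * (k + 1) ≤ rowRank (blowup A X)
  have hQ0 : Q 0 := ⟨0, fun _ => 0, by simp⟩
  have hQle : ∀ r, Q r → r ≤ Fintype.card κ := by
    rintro r ⟨k, X, h⟩
    have := h.trans (rowRank_le_card_right _)
    rw [Fintype.card_prod, Fintype.card_fin] at this
    exact Nat.le_of_mul_le_mul_right this (Nat.succ_pos k)
  obtain ⟨r, ⟨k, T, hT⟩, hr⟩ : ∃ r, Q r ∧ ∀ r', Q r' → r' ≤ r :=
    ⟨Nat.findGreatest Q (Fintype.card κ), Nat.findGreatest_spec (Nat.zero_le _) hQ0,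
      fun r' h => Nat.le_findGreatest (hQle r' h) h⟩
  -- The rank over a skew field is an integer, and it dominates the normalized rank while still
  -- being reached by a blow-up. So the largest integer `r` bounds the fractional normalized ranks
  -- too.
  have hbound : ∀ (k : ℕ) (X : m → Matrix (Fin (k + 1)) (Fin (k + 1)) E),
      rowRank (blowup A X) ≤ r * (k + 1) := by
    intro k X
    obtain ⟨K, _, _, a, X', h1, h2⟩ := exists_divisionRing_rank A X
    exact h1.trans (Nat.mul_le_mul_right _ (hr _ ⟨k, X', h2⟩))
  obtain ⟨K, _, _, a, -, h1, -⟩ := exists_divisionRing_rank A T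
  have hra : r ≤ rowRank (pencil A a) :=
    Nat.le_of_mul_le_mul_right (hT.trans h1) (Nat.succ_pos k)
  obtain ⟨U, hU⟩ := exists_shrunk_subspace A T (by
    intro s X
    obtain ⟨k', hk'⟩ : ∃ k', (s + 1) * (k + 1) = k' + 1 :=
      ⟨_, (Nat.succ_pred_eq_of_pos (Nat.mul_pos s.succ_pos k.succ_pos)).symm⟩
    let e : Fin (s + 1) × Fin (k + 1) ≃ Fin (k' + 1) := Fintype.equivFinOfCardEq (by simpa using hk')
    rw [← rowRank_blowup_reindex A X e.symm]
    refine (hbound k' _).trans ?_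
    rw [← hk', mul_left_comm]
    exact Nat.mul_le_mul_left _ hT)
  refine ⟨K, inferInstance, inferInstance, a, U, ?_⟩
  have h2 := hbound k T
  rw [Fintype.card_fin] at hU
  have h3 : (k + 1) * (Fintype.card κ + Module.finrank E (pencilImage A U)) ≤
      (k + 1) * (Module.finrank E U + r) := by
    rw [mul_add, mul_add, mul_comm _ (Fintype.card κ), mul_comm _ r]
    omega
  have := Nat.le_of_mul_le_mul_left h3 (Nat.succ_pos k)
  omega

end MaximalRank

/-! ### Descent along a purely transcendental extension -/

section Descent

open Polynomial Matrix

variable {F : Type*} [Field F] {E : Type*} [Field E] [Algebra F E] [Algebra F[X] E]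
  [IsFractionRing F[X] E] [IsScalarTower F F[X] E] {κ ι : Type*} [Fintype κ] [Fintype ι]

/-- The polynomial vectors in a subspace of `F(t)^κ`. -/
noncomputable def polyLattice (U : Submodule E (κ → E)) : Submodule F[X] (κ → F[X]) :=
  (U.restrictScalars F[X]).comap ((Algebra.linearMap F[X] E).compLeft κ)

lemma mem_polyLattice {U : Submodule E (κ → E)} {f : κ → F[X]} :
    f ∈ polyLattice U ↔ (fun i => algebraMap F[X] E (f i)) ∈ U := Iff.rfl

/-- The reduction modulo `t` of a subspace of `F(t)^κ`. -/
noncomputable def reduction (U : Submodule E (κ → E)) : Submodule F (κ → F) :=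
  ((polyLattice (F := F) U).restrictScalars F).map (((aeval (0 : F)).toLinearMap).compLeft κ)

lemma mem_reduction {U : Submodule E (κ → E)} {z : κ → F} :
    z ∈ reduction U ↔ ∃ f ∈ polyLattice (F := F) U, (fun i => (f i).eval 0) = z := by
  rw [reduction, Submodule.mem_map]
  refine exists_congr fun f => and_congr Iff.rfl ?_
  have : (((aeval (0 : F)).toLinearMap).compLeft κ) f = fun i => (f i).eval 0 := by
    ext i
    simp
  rw [this]

/-- The polynomial vectors in `U` form a free lattice. A basis of it is a basis of `U` over `F(t)`,
by clearing denominators, and it reduces to a basis modulo `t` because the lattice is saturated. -/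
lemma finrank_reduction (U : Submodule E (κ → E)) :
    Module.finrank F (reduction (F := F) U) = Module.finrank E U := by
  classical
  let Λ := polyLattice (F := F) U
  let b := Module.Free.chooseBasis F[X] Λ
  let a := algebraMap F[X] E
  have ha : Function.Injective a := IsFractionRing.injective F[X] E
  have hU : Module.finrank E U = Fintype.card (Module.Free.ChooseBasisIndex F[X] Λ) := by
    let v : Module.Free.ChooseBasisIndex F[X] Λ → κ → E := fun i j => a ((b i : κ → F[X]) j)
    have hli : LinearIndependent E v := by
      rw [← LinearIndependent.iff_fractionRing F[X] E]
      have h1 : LinearIndependent F[X]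
          (((Algebra.linearMap F[X] E).compLeft κ ∘ₗ Λ.subtype) ∘ b) := by
        refine b.linearIndependent.map' _ ?_
        rw [LinearMap.ker_eq_bot]
        intro f g hfg
        ext1
        ext1 j
        exact ha (congrFun hfg j)
      exact h1
    have hspan : Submodule.span E (Set.range v) = U := by
      apply le_antisymm
      · rw [Submodule.span_le]
        rintro _ ⟨i, rfl⟩
        exact (b i).2
      · intro u hu
        obtain ⟨c, hc⟩ := IsLocalization.exist_integer_multiples_of_finite (nonZeroDivisors F[X]) u
        choose f hf using hc
        have hc0 : a c ≠ 0 := fun h => nonZeroDivisors.ne_zero c.2 (ha (h.trans (map_zero a).symm))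
        have hf' : (fun j => a (f j)) = a c • u := by
          ext j
          rw [show a (f j) = _ from hf j, Algebra.smul_def]
          rfl
        have hfΛ : f ∈ Λ := by
          rw [mem_polyLattice]
          change (fun j => a (f j)) ∈ U
          rw [hf']
          exact U.smul_mem _ hu
        have h2 := congrArg Subtype.val (b.sum_repr ⟨f, hfΛ⟩)
        have h3 : a c • u = ∑ i, a (b.repr ⟨f, hfΛ⟩ i) • v i := by
          rw [← hf']
          ext j
          have h4 := congrArg a (congrFun h2 j)
          simp only [Submodule.coe_sum, Finset.sum_apply, Submodule.coe_smul, Pi.smul_apply,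
            smul_eq_mul, map_sum, map_mul] at h4
          rw [← h4]
          simp [v, Finset.sum_apply]
        rw [← inv_smul_smul₀ hc0 u, h3]
        refine Submodule.smul_mem _ _ (Submodule.sum_mem _ fun i _ => Submodule.smul_mem _ _ ?_)
        exact Submodule.subset_span ⟨i, rfl⟩
    rw [← hspan, finrank_span_eq_card hli]
  have hF : Module.finrank F (reduction (F := F) U) =
      Fintype.card (Module.Free.ChooseBasisIndex F[X] Λ) := by
    let v : Module.Free.ChooseBasisIndex F[X] Λ → κ → F := fun i j => ((b i : κ → F[X]) j).eval 0
    have hli : LinearIndependent F v := by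
      rw [Fintype.linearIndependent_iff]
      intro c hc i
      let f : Λ := ∑ i, C (c i) • b i
      have hf : ∀ j, X ∣ (f : κ → F[X]) j := by
        intro j
        rw [X_dvd_iff, coeff_zero_eq_eval_zero]
        have := congrFun hc j
        simp only [Finset.sum_apply, Pi.smul_apply, smul_eq_mul, Pi.zero_apply, v] at this
        simpa [f, Submodule.coe_sum, Finset.sum_apply, eval_finsetSum] using this
      choose g hg using hf
      have hX : a X ≠ 0 := fun h => X_ne_zero (ha (h.trans (map_zero a).symm))
      -- Saturation: division by `t` stays in the lattice. A constant combination of the basis that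
      -- vanishes at 0 is thus `t` times a lattice vector, so its coefficients are constants
      -- divisible by `t`.
      have hgΛ : g ∈ Λ := by
        have h1 : (fun j => a ((f : κ → F[X]) j)) ∈ U := f.2
        have h2 : (fun j => a ((f : κ → F[X]) j)) = a X • fun j => a (g j) := by
          ext j
          rw [hg, map_mul]; rfl
        rw [h2] at h1
        exact (U.smul_mem_iff hX).1 h1
      have h3 : f = (X : F[X]) • (⟨g, hgΛ⟩ : Λ) := by
        ext1
        ext1 j
        exact hg j
      have h4 : b.repr f i = C (c i) := by
        simp only [f]
        rw [b.repr_sum_self]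
      rw [h3, map_smul, Finsupp.smul_apply, smul_eq_mul] at h4
      have h5 := congrArg (eval 0) h4
      simpa using h5.symm
    have hspan : Submodule.span F (Set.range v) = reduction (F := F) U := by
      apply le_antisymm
      · rw [Submodule.span_le]
        rintro _ ⟨i, rfl⟩
        exact mem_reduction.2 ⟨b i, (b i).2, rfl⟩
      · intro z hz
        obtain ⟨f, hf, rfl⟩ := mem_reduction.1 hz
        have h2 := congrArg Subtype.val (b.sum_repr ⟨f, hf⟩)
        have h3 : (fun j => (f j).eval 0) = ∑ i, (b.repr ⟨f, hf⟩ i).eval 0 • v i := by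
          ext j
          have h4 := congrArg (eval 0) (congrFun h2 j)
          simp only [Submodule.coe_sum, Finset.sum_apply, Submodule.coe_smul, Pi.smul_apply,
            smul_eq_mul, eval_finsetSum, eval_mul] at h4
          rw [← h4]
          simp [v, Finset.sum_apply]
        rw [h3]
        exact Submodule.sum_mem _ fun i _ => Submodule.smul_mem _ _ (Submodule.subset_span ⟨i, rfl⟩)
    rw [← hspan, finrank_span_eq_card hli]
  rw [hU, hF]

/-- The matrices `A k` have constant entries, so they commute with evaluation at 0. -/
lemma pencilImage_reduction_le {m : Type*} [Fintype m] (A : m → Matrix ι κ F)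
    (U : Submodule E (κ → E)) :
    pencilImage A (reduction (F := F) U) ≤
      reduction (pencilImage (fun k => (A k).map (algebraMap F E)) U) := by
  rw [pencilImage_le]
  intro k z hz
  obtain ⟨f, hf, rfl⟩ := mem_reduction.1 hz
  rw [mem_reduction]
  refine ⟨(A k).map C *ᵥ f, ?_, ?_⟩
  · rw [mem_polyLattice]
    convert! mulVec_mem_pencilImage (A := fun k => (A k).map (algebraMap F E)) k
      (mem_polyLattice.1 hf) using 1
    ext i
    simp only [Matrix.mulVec, dotProduct, map_sum, map_mul, Matrix.map_apply]
    refine Finset.sum_congr rfl fun j _ => ?_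
    rw [IsScalarTower.algebraMap_apply F F[X] E]
    rfl
  · ext i
    simp [Matrix.mulVec, dotProduct, eval_finsetSum]

end Descent

/-- The corank of a pencil at a suitable point of a division ring is at most the amount by which
some subspace is shrunk. -/
theorem exists_point_and_shrunk_subspace {F : Type u} [Field F]
    {m ι κ : Type*} [Fintype m] [Fintype ι] [Fintype κ] (A : m → Matrix ι κ F) :
    ∃ (K : Type u) (_ : DivisionRing K) (_ : Algebra F K) (a : m → K) (U : Submodule F (κ → F)),
      Fintype.card κ + Module.finrank F (pencilImage A U) ≤
        Module.finrank F U + rowRank (pencil A a) := by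
  let E := FractionRing (Polynomial F)
  have : Infinite E := Infinite.of_injective _ (IsFractionRing.injective (Polynomial F) E)
  obtain ⟨K, _, _, a, U, h⟩ := exists_point_and_shrunk_subspace_of_infinite
    (fun k => (A k).map (algebraMap F E))
  let _ : Algebra F K := Algebra.compHom K (algebraMap F E)
  refine ⟨K, inferInstance, inferInstance, a, reduction U, ?_⟩
  rw [finrank_reduction]
  have h1 := Submodule.finrank_mono (pencilImage_reduction_le A U)
  rw [finrank_reduction] at h1
  have h2 : pencil A a = pencil (fun k => (A k).map (algebraMap F E)) a := rfl
  rw [h2]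
  omega

/-! ### Nonsingular matrices and full pencils -/

section Nonsingular

open Matrix

variable {D : Type*} [DivisionRing D] {ι κ : Type*} [Fintype ι] [Fintype κ]

/-- A square matrix acting surjectively on columns. -/
def IsNonsing (M : Matrix ι ι D) : Prop := Function.Surjective M.mulVec

lemma IsNonsing.exists_inv [DecidableEq ι] {M : Matrix ι ι D} (h : IsNonsing M) :
    ∃ N, M * N = 1 ∧ N * M = 1 := by
  choose g hg using h
  have h1 : M * (Matrix.of fun j => g (Pi.single j 1))ᵀ = 1 := by
    ext i j
    have := congrFun (hg (Pi.single j 1)) i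
    rw [Matrix.one_apply, ← Pi.single_apply, Pi.single_comm]
    exact this.trans (by rw [Pi.single_apply, Pi.single_apply]; simp [eq_comm])
  exact ⟨_, h1, mul_eq_one_symm h1⟩

lemma IsNonsing.injective {M : Matrix ι ι D} (h : IsNonsing M) : Function.Injective M.mulVec := by
  classical
  obtain ⟨N, -, hN⟩ := h.exists_inv
  intro v w hvw
  have := congrArg N.mulVec hvw
  simpa [Matrix.mulVec_mulVec, hN] using this

lemma IsNonsing.of_mul_eq_one [DecidableEq ι] {M N : Matrix ι ι D} (h : M * N = 1) :
    IsNonsing M := fun v => ⟨N *ᵥ v, by rw [Matrix.mulVec_mulVec, h, Matrix.one_mulVec]⟩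

lemma isNonsing_iff_rowRank {M : Matrix ι ι D} : IsNonsing M ↔ Fintype.card ι ≤ rowRank M := by
  classical
  constructor
  · intro h
    obtain ⟨N, hN, -⟩ := h.exists_inv
    exact le_rowRank_of_mul_eq_one (P := 1) (Q := N) (by rw [Matrix.one_mul, hN])
  · intro h
    obtain ⟨P, Q, h⟩ := hasRankGE_iff.2 h
    let e := Fintype.equivFin ι
    have h1 : P.submatrix e id * (M * Q.submatrix id e) = 1 := by
      rw [← Matrix.mul_assoc]
      have : P.submatrix e id * M * Q.submatrix id e = (P * M * Q).submatrix e e := by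
        ext i j; simp [Matrix.mul_apply]
      rw [this, h, Matrix.submatrix_one _ e.injective]
    have h2 := mul_eq_one_symm h1
    rw [Matrix.mul_assoc] at h2
    exact IsNonsing.of_mul_eq_one h2

lemma isNonsing_fromBlocks {P : Matrix ι ι D} {R : Matrix ι κ D} {Q : Matrix κ κ D} :
    IsNonsing (fromBlocks P R 0 Q) ↔ IsNonsing P ∧ IsNonsing Q := by
  constructor
  · intro h
    have hQ : IsNonsing Q := by
      intro w
      obtain ⟨y, hy⟩ := h (Sum.elim 0 w)
      rw [Matrix.fromBlocks_mulVec] at hy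
      refine ⟨y ∘ Sum.inr, ?_⟩
      have := congrArg (fun f => f ∘ Sum.inr) hy
      simpa using this
    refine ⟨fun w => ?_, hQ⟩
    obtain ⟨y, hy⟩ := h (Sum.elim w 0)
    rw [Matrix.fromBlocks_mulVec] at hy
    have h1 := congrArg (fun f => f ∘ Sum.inr) hy
    have h2 := congrArg (fun f => f ∘ Sum.inl) hy
    simp only [Sum.elim_comp_inr, Sum.elim_comp_inl, Matrix.zero_mulVec, zero_add] at h1 h2
    have h3 : y ∘ Sum.inr = 0 := hQ.injective (by rw [h1, Matrix.mulVec_zero])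
    rw [h3, Matrix.mulVec_zero, add_zero] at h2
    exact ⟨_, h2⟩
  · rintro ⟨hP, hQ⟩ w
    obtain ⟨y2, hy2⟩ := hQ (w ∘ Sum.inr)
    obtain ⟨y1, hy1⟩ := hP (w ∘ Sum.inl - R *ᵥ y2)
    refine ⟨Sum.elim y1 y2, ?_⟩
    rw [Matrix.fromBlocks_mulVec]
    simp [hy1, hy2]

end Nonsingular

/-! ### Pencils without shrunk subspaces. -/

section Full

open Matrix

variable {F : Type*} [Field F] {m : Type*} [Fintype m] {ι κ : Type*} [Fintype ι] [Fintype κ]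

/-- A pencil without shrunk subspace. -/
def IsFullPencil (A : m → Matrix ι ι F) : Prop :=
  ∀ U : Submodule F (ι → F), Module.finrank F U ≤ Module.finrank F (pencilImage A U)

lemma IsNonsing.isFullPencil {D : Type*} [DivisionRing D] [Algebra F D] {A : m → Matrix ι ι F}
    {x : m → D} (h : IsNonsing (pencil A x)) : IsFullPencil A := by
  intro U
  have h1 := finrank_add_rowRank_pencil_le A x U
  have h2 := isNonsing_iff_rowRank.1 h
  omega

lemma IsFullPencil.exists_isNonsing {F : Type u} [Field F] {A : m → Matrix ι ι F}
    (h : IsFullPencil A) : ∃ (K : Type u) (_ : DivisionRing K) (_ : Algebra F K) (a : m → K),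
      IsNonsing (pencil A a) := by
  obtain ⟨K, _, _, a, U, hU⟩ := exists_point_and_shrunk_subspace A
  refine ⟨K, inferInstance, inferInstance, a, isNonsing_iff_rowRank.2 ?_⟩
  have := h U
  omega

/-- The block diagonal sum of pencils. -/
def pencilSum (A : m → Matrix ι ι F) (B : m → Matrix κ κ F) : m → Matrix (ι ⊕ κ) (ι ⊕ κ) F :=
  fun k => fromBlocks (A k) 0 0 (B k)

lemma pencilSum_mulVec (A : m → Matrix ι ι F) (B : m → Matrix κ κ F) (k : m) (v : ι ⊕ κ → F) :
    pencilSum A B k *ᵥ v = Sum.elim (A k *ᵥ (v ∘ Sum.inl)) (B k *ᵥ (v ∘ Sum.inr)) := by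
  rw [pencilSum, Matrix.fromBlocks_mulVec]
  simp

/-- Each subspace is cut into its projection to the first summand and its intersection with the
second. Both operations are compatible with a block diagonal pencil, and the dimensions add up. -/
lemma IsFullPencil.sum {A : m → Matrix ι ι F} {B : m → Matrix κ κ F} (hA : IsFullPencil A)
    (hB : IsFullPencil B) : IsFullPencil (pencilSum A B) := by
  intro U
  let inr : (κ → F) →ₗ[F] (ι ⊕ κ → F) :=
    { toFun := fun z => Sum.elim 0 z
      map_add' := fun z w => by ext (i | i) <;> simp
      map_smul' := fun z w => by ext (i | i) <;> simp }
  let pr := LinearMap.funLeft F F (Sum.inl : ι → ι ⊕ κ)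
  have hpr : ∀ v, pr v = v ∘ Sum.inl := fun _ => rfl
  have hdim : ∀ V : Submodule F (ι ⊕ κ → F),
      Module.finrank F (V.map pr) + Module.finrank F (V.comap inr) = Module.finrank F V := by
    intro V
    rw [← LinearMap.finrank_range_add_finrank_ker (pr.domRestrict V)]
    congr 1
    · rw [LinearMap.range_domRestrict]
    · rw [← Submodule.finrank_map_subtype_eq V]
      have hinj : Function.Injective inr := by
        intro z w h
        ext i
        exact congrFun h (Sum.inr i)
      rw [LinearEquiv.finrank_eq (Submodule.equivMapOfInjective inr hinj (V.comap inr))]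
      suffices h : (V.comap inr).map inr = (LinearMap.ker (pr.domRestrict V)).map V.subtype by rw [h]
      ext v
      constructor
      · rintro ⟨z, hz, rfl⟩
        exact ⟨⟨inr z, hz⟩, by ext i; rfl, rfl⟩
      · rintro ⟨⟨v, hv⟩, hv0, rfl⟩
        have hv0' : v ∘ Sum.inl = 0 := hv0
        have : inr (v ∘ Sum.inr) = v := by
          ext (i | i)
          · exact (congrFun hv0' i).symm
          · rfl
        exact ⟨v ∘ Sum.inr, by rw [SetLike.mem_coe, Submodule.mem_comap, this]; exact hv, this⟩
  rw [← hdim U, ← hdim (pencilImage (pencilSum A B) U)]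
  apply add_le_add
  · refine (hA _).trans (Submodule.finrank_mono (pencilImage_le.2 ?_))
    rintro k _ ⟨v, hv, rfl⟩
    exact ⟨_, mulVec_mem_pencilImage k hv, by rw [pencilSum_mulVec, hpr, hpr]; simp⟩
  · refine (hB _).trans (Submodule.finrank_mono (pencilImage_le.2 ?_))
    intro k z hz
    have h1 := mulVec_mem_pencilImage (A := pencilSum A B) k (Submodule.mem_comap.1 hz)
    rw [pencilSum_mulVec] at h1
    rw [Submodule.mem_comap]
    convert! h1 using 1
    ext (i | i)
    · simp [inr]
    · rfl

lemma pencil_fromBlocks {R : Type*} [Ring R] [Algebra F R] (A : m → Matrix ι ι F)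
    (B : m → Matrix ι κ F) (C : m → Matrix κ ι F) (D : m → Matrix κ κ F) (x : m → R) :
    pencil (fun k => fromBlocks (A k) (B k) (C k) (D k)) x =
      fromBlocks (pencil A x) (pencil B x) (pencil C x) (pencil D x) := by
  ext (i | i) (j | j) <;> rfl

lemma pencil_zero {R : Type*} [Ring R] [Algebra F R] (x : m → R) :
    pencil (fun _ => (0 : Matrix ι κ F)) x = 0 := by
  ext i j
  simp [pencil]

lemma isNonsing_pencilSum {D : Type*} [DivisionRing D] [Algebra F D] {A : m → Matrix ι ι F}
    {B : m → Matrix κ κ F} {x : m → D} :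
    IsNonsing (pencil (pencilSum A B) x) ↔ IsNonsing (pencil A x) ∧ IsNonsing (pencil B x) := by
  rw [← isNonsing_fromBlocks (R := 0), ← pencil_zero (F := F) x, ← pencil_zero (F := F) x,
    ← pencil_fromBlocks]
  rfl

end Full

/-! ### Linearization of rational expressions -/

section Linearization

open Matrix

/-- Homogeneous coordinates of a point. -/
def homPoint {R : Type*} [One R] {m : ℕ} (a : Fin m → R) : Option (Fin m) → R :=
  fun o => o.elim 1 a

/-- A constant matrix as a pencil in homogeneous coordinates. -/
def constPencil {F ι κ : Type*} [Field F] {m : ℕ} (N : Matrix ι κ F) :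
    Option (Fin m) → Matrix ι κ F :=
  fun o => o.elim N fun _ => 0

variable {F : Type u} [Field F] {m : ℕ} {ι κ : Type} [Fintype ι] [Fintype κ]

lemma pencil_constPencil {R : Type*} [Ring R] [Algebra F R] (N : Matrix ι κ F) (a : Fin m → R) :
    pencil (constPencil N) (homPoint a) = N.map (algebraMap F R) := by
  ext i j
  simp [pencil, constPencil, homPoint, Fintype.sum_option]

/-- A linear representation of a rational expression: a pencil `L` which is nonsingular exactly
where the expression is defined, with value `u L⁻¹ v`. -/
structure Linearization (p : NCRatExpr F m) where
  /-- the index set -/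
  idx : Type
  [fintype : Fintype idx]
  /-- the pencil -/
  L : Option (Fin m) → Matrix idx idx F
  /-- the row -/
  u : idx → F
  /-- the column -/
  v : idx → F
  definedAt_iff : ∀ (K : Type u) [DivisionRing K] [Algebra F K] (a : Fin m → K),
    p.DefinedAt a ↔ IsNonsing (pencil L (homPoint a))
  eval_eq : ∀ (K : Type u) [DivisionRing K] [Algebra F K] (a : Fin m → K), p.DefinedAt a →
    ∀ y, pencil L (homPoint a) *ᵥ y = (fun i => algebraMap F K (v i)) →
      ∑ i, algebraMap F K (u i) * y i = p.eval a

attribute [instance] Linearization.fintype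

lemma vecMulVec_map_mulVec {K : Type*} [DivisionRing K] [Algebra F K] (v : ι → F) (u : κ → F)
    (y : κ → K) :
    (vecMulVec v u).map (algebraMap F K) *ᵥ y =
      fun i => algebraMap F K (v i) * ∑ j, algebraMap F K (u j) * y j := by
  ext i
  simp [Matrix.mulVec, dotProduct, vecMulVec_apply, Finset.mul_sum, mul_assoc]

lemma mulVec_mul_right {K : Type*} [DivisionRing K] (M : Matrix ι κ K) (y : κ → K) (s : K) :
    M *ᵥ (fun i => y i * s) = fun i => (M *ᵥ y) i * s := by
  ext i
  simp [Matrix.mulVec, dotProduct, Finset.sum_mul, mul_assoc]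

lemma replicateCol_map_mulVec {K : Type*} [DivisionRing K] [Algebra F K] (v : ι → F)
    (s : Unit → K) : (replicateCol Unit v).map (algebraMap F K) *ᵥ s =
      fun i => algebraMap F K (v i) * s () := by
  ext i
  simp [Matrix.mulVec, dotProduct]

lemma replicateRow_map_mulVec {K : Type*} [DivisionRing K] [Algebra F K] (u : κ → F)
    (y : κ → K) : (replicateRow Unit u).map (algebraMap F K) *ᵥ y =
      fun _ => ∑ i, algebraMap F K (u i) * y i := by
  ext i
  simp [Matrix.mulVec, dotProduct]

/-- Constants. -/
def Linearization.const (c : F) : Linearization (.const c : NCRatExpr F m) where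
  idx := Unit
  L := constPencil 1
  u := fun _ => c
  v := fun _ => 1
  definedAt_iff K _ _ a := by
    rw [pencil_constPencil, Matrix.map_one _ (map_zero _) (map_one _)]
    exact iff_of_true trivial fun v => ⟨v, Matrix.one_mulVec v⟩
  eval_eq K _ _ a _ y hy := by
    rw [pencil_constPencil, Matrix.map_one _ (map_zero _) (map_one _), Matrix.one_mulVec] at hy
    simp [hy, NCRatExpr.eval]

/-- Variables. -/
def Linearization.var (k : Fin m) : Linearization (.var k : NCRatExpr F m) where
  idx := Unit ⊕ Unit
  -- The matrix `[1, -x_k; 0, 1]`, whose inverse has `x_k` in the corner.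
  L := fun o => fromBlocks (constPencil 1 o) (o.elim 0 fun l => Matrix.of fun _ _ => if l = k then -1 else 0) 0
    (constPencil 1 o)
  u := Sum.elim 1 0
  v := Sum.elim 0 1
  definedAt_iff K _ _ a := by
    rw [pencil_fromBlocks, pencil_constPencil, Matrix.map_one _ (map_zero _) (map_one _),
      pencil_zero, isNonsing_fromBlocks]
    have h : IsNonsing (1 : Matrix Unit Unit K) := fun v => ⟨v, Matrix.one_mulVec v⟩
    exact iff_of_true trivial ⟨h, h⟩
  eval_eq K _ _ a _ y hy := by
    rw [pencil_fromBlocks, pencil_constPencil, Matrix.map_one _ (map_zero _) (map_one _),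
      pencil_zero, Matrix.fromBlocks_mulVec] at hy
    have h1 := congrFun hy (Sum.inr ())
    have h2 := congrFun hy (Sum.inl ())
    simp only [Matrix.one_mulVec, Matrix.zero_mulVec, zero_add, Sum.elim_inr, Sum.elim_inl,
      Pi.add_apply, Pi.one_apply, Pi.zero_apply, map_one, map_zero] at h1 h2
    have h1 : y (Sum.inr ()) = 1 := h1
    have h3 : (pencil (F := F) (fun o : Option (Fin m) => (o.elim 0 fun l =>
        Matrix.of fun _ _ => if l = k then -1 else 0 : Matrix Unit Unit F)) (homPoint a) *ᵥ
          (y ∘ Sum.inr)) () = - a k := by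
      simp only [Matrix.mulVec, dotProduct, pencil, homPoint, Fintype.sum_option, Function.comp]
      simp [h1, apply_ite]
    rw [h3] at h2
    simp only [Fintype.sum_sum_type, Sum.elim_inl, Sum.elim_inr, NCRatExpr.eval]
    simpa using eq_of_sub_eq_zero (by rw [sub_eq_add_neg]; exact h2)

/-- Sums. -/
def Linearization.add {p q : NCRatExpr F m} (P : Linearization p) (Q : Linearization q) :
    Linearization (.add p q) where
  idx := P.idx ⊕ Q.idx
  L := pencilSum P.L Q.L
  u := Sum.elim P.u Q.u
  v := Sum.elim P.v Q.v
  definedAt_iff K _ _ a := by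
    rw [isNonsing_pencilSum, ← P.definedAt_iff, ← Q.definedAt_iff]
    rfl
  eval_eq K _ _ a h y hy := by
    have hP := P.eval_eq K a h.1 (y ∘ Sum.inl)
    have hQ := Q.eval_eq K a h.2 (y ∘ Sum.inr)
    change pencil (fun k => fromBlocks (P.L k) 0 0 (Q.L k)) _ *ᵥ y = _ at hy
    rw [pencil_fromBlocks, pencil_zero, pencil_zero, Matrix.fromBlocks_mulVec] at hy
    have h1 := hP (by ext i; simpa using congrFun hy (Sum.inl i))
    have h2 := hQ (by ext i; simpa using congrFun hy (Sum.inr i))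
    rw [Fintype.sum_sum_type, NCRatExpr.eval, ← h1, ← h2]
    rfl

/-- Products. -/
def Linearization.mul {p q : NCRatExpr F m} (P : Linearization p) (Q : Linearization q) :
    Linearization (.mul p q) where
  idx := P.idx ⊕ Q.idx
  -- The lower block solves to `L_q⁻¹ v_q`; the corner `-v_p u_q` then feeds the value of `q` into
  -- the upper block as a right factor.
  L := fun o => fromBlocks (P.L o) (constPencil (-vecMulVec P.v Q.u) o) 0 (Q.L o)
  u := Sum.elim P.u 0
  v := Sum.elim 0 Q.v
  definedAt_iff K _ _ a := by
    rw [pencil_fromBlocks, pencil_zero, isNonsing_fromBlocks, ← P.definedAt_iff, ← Q.definedAt_iff]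
    rfl
  eval_eq K _ _ a h y hy := by
    rw [pencil_fromBlocks, pencil_zero, pencil_constPencil, Matrix.fromBlocks_mulVec] at hy
    have h1 := Q.eval_eq K a h.2 (y ∘ Sum.inr) (by ext i; simpa using congrFun hy (Sum.inr i))
    have h2 : pencil P.L (homPoint a) *ᵥ (y ∘ Sum.inl) =
        fun i => algebraMap F K (P.v i) * q.eval a := by
      ext i
      have h3 := congrFun hy (Sum.inl i)
      have h4 : (-vecMulVec P.v Q.u).map (algebraMap F K) =
          -(vecMulVec P.v Q.u).map (algebraMap F K) := by
        ext; simp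
      simp only [Sum.elim_inl, Pi.add_apply, h4, Matrix.neg_mulVec, vecMulVec_map_mulVec, h1,
        Pi.neg_apply, Pi.zero_apply, map_zero] at h3
      exact eq_of_sub_eq_zero (by rw [sub_eq_add_neg]; exact h3)
    obtain ⟨z, hz⟩ := (P.definedAt_iff K a).1 h.1 fun i => algebraMap F K (P.v i)
    have h5 := P.eval_eq K a h.1 z hz
    have h6 : y ∘ Sum.inl = fun i => z i * q.eval a := by
      apply ((P.definedAt_iff K a).1 h.1).injective
      rw [h2, mulVec_mul_right, hz]
    have h7 : ∀ i, y (Sum.inl i) = z i * q.eval a := fun i => congrFun h6 i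
    rw [Fintype.sum_sum_type, NCRatExpr.eval, ← h5, Finset.sum_mul]
    simp [h7, mul_assoc]

/-- Where `L` is invertible, the Schur complement of the bordered matrix `[L, v; u, 0]` is `-u L⁻¹
v`, minus the value of `p`. -/
lemma isNonsing_inv_block {p : NCRatExpr F m} (P : Linearization p) {K : Type u} [DivisionRing K]
    [Algebra F K] {a : Fin m → K} (h : p.DefinedAt a) :
    IsNonsing (pencil (fun o => fromBlocks (P.L o) (constPencil (replicateCol Unit P.v) o)
      (constPencil (replicateRow Unit P.u) o) 0) (homPoint a)) ↔ p.eval a ≠ 0 := by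
  have hP := (P.definedAt_iff K a).1 h
  obtain ⟨z, hz⟩ := hP fun i => algebraMap F K (P.v i)
  have hpz := P.eval_eq K a h z hz
  rw [pencil_fromBlocks, pencil_constPencil, pencil_constPencil, pencil_zero]
  constructor
  · intro hN h0
    obtain ⟨y, hy⟩ := hN (Sum.elim 0 1)
    rw [Matrix.fromBlocks_mulVec, replicateCol_map_mulVec, replicateRow_map_mulVec] at hy
    have h1 : pencil P.L (homPoint a) *ᵥ (y ∘ Sum.inl) = fun i =>
        algebraMap F K (P.v i) * -y (Sum.inr ()) := by
      ext i
      have h2 := congrFun hy (Sum.inl i)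
      simp only [Sum.elim_inl, Pi.add_apply, Pi.zero_apply] at h2
      rw [mul_neg]
      exact eq_neg_of_add_eq_zero_left h2
    have h2 : y ∘ Sum.inl = fun i => z i * -y (Sum.inr ()) := by
      apply hP.injective
      rw [h1, mulVec_mul_right, hz]
    have h3 := congrFun hy (Sum.inr ())
    rw [h2] at h3
    simp only [Sum.elim_inr, Pi.add_apply, ← mul_assoc, ← Finset.sum_mul, hpz, h0] at h3
    simp at h3
  · intro h0 w
    obtain ⟨t, ht⟩ := hP (w ∘ Sum.inl)
    let s := (p.eval a)⁻¹ * ((∑ i, algebraMap F K (P.u i) * t i) - w (Sum.inr ()))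
    refine ⟨Sum.elim (t - fun i => z i * s) fun _ => s, ?_⟩
    rw [Matrix.fromBlocks_mulVec, replicateCol_map_mulVec, replicateRow_map_mulVec]
    ext (i | i)
    · simp only [Sum.elim_comp_inl, Sum.elim_inl, Pi.add_apply, Matrix.mulVec_sub, ht,
        mulVec_mul_right, hz, Pi.sub_apply, Function.comp, Sum.elim_inr]
      abel
    · simp only [Sum.elim_comp_inl, Sum.elim_inr, Pi.sub_apply, mul_sub,
        Finset.sum_sub_distrib, Matrix.zero_mulVec, add_zero, ← mul_assoc,
        ← Finset.sum_mul, hpz]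
      simp only [s, mul_inv_cancel_left₀ h0]
      abel

/-- Inverses. -/
def Linearization.inv {p : NCRatExpr F m} (P : Linearization p) : Linearization (.inv p) where
  idx := P.idx ⊕ (P.idx ⊕ Unit)
  -- The separate summand `P.L` records that `p` is defined, since a bordered matrix can be
  -- nonsingular where `L` is not. The last coordinate of the solution is minus the inverse, whence
  -- the sign in `u`.
  L := pencilSum P.L fun o => fromBlocks (P.L o) (constPencil (replicateCol Unit P.v) o)
      (constPencil (replicateRow Unit P.u) o) 0
  u := Sum.elim 0 (Sum.elim 0 (-1))
  v := Sum.elim 0 (Sum.elim 0 1)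
  definedAt_iff K _ _ a := by
    rw [isNonsing_pencilSum, ← P.definedAt_iff]
    exact and_congr_right fun h => (isNonsing_inv_block P h).symm
  eval_eq K _ _ a h y hy := by
    obtain ⟨h, h0⟩ := h
    have hP := (P.definedAt_iff K a).1 h
    obtain ⟨z, hz⟩ := hP fun i => algebraMap F K (P.v i)
    have hpz := P.eval_eq K a h z hz
    unfold pencilSum at hy
    rw [pencil_fromBlocks, pencil_fromBlocks, pencil_constPencil, pencil_constPencil, pencil_zero,
      pencil_zero, pencil_zero, Matrix.fromBlocks_mulVec, Matrix.fromBlocks_mulVec, replicateCol_map_mulVec,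
      replicateRow_map_mulVec] at hy
    set s := y (Sum.inr (Sum.inr ())) with hs
    have h1 : pencil P.L (homPoint a) *ᵥ (fun i => y (Sum.inr (Sum.inl i))) = fun i =>
        algebraMap F K (P.v i) * -s := by
      ext i
      have h2 := congrFun hy (Sum.inr (Sum.inl i))
      simp only [Sum.elim_inl, Sum.elim_inr, Pi.add_apply, Pi.zero_apply, map_zero,
        Matrix.zero_mulVec, zero_add] at h2
      rw [mul_neg]
      exact eq_neg_of_add_eq_zero_left h2
    have h2 : (fun i => y (Sum.inr (Sum.inl i))) = fun i => z i * -s := by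
      apply hP.injective
      rw [h1, mulVec_mul_right, hz]
    have h3 : ∀ i, y (Sum.inr (Sum.inl i)) = z i * -s := congrFun h2
    have h4 := congrFun hy (Sum.inr (Sum.inr ()))
    simp only [Sum.elim_inr, Function.comp, h3, Matrix.zero_mulVec,
      ← mul_assoc, ← Finset.sum_mul, hpz, zero_add, add_zero, Pi.one_apply, map_one] at h4
    simp only [Fintype.sum_sum_type, Sum.elim_inl, Sum.elim_inr, Pi.zero_apply, map_zero, zero_mul,
      Finset.sum_const_zero, zero_add, NCRatExpr.eval]
    simp only [Finset.univ_unique, Finset.sum_singleton, Pi.neg_apply, Pi.one_apply, map_neg,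
      map_one, neg_one_mul]
    exact eq_inv_of_mul_eq_one_right h4

/-- Every rational expression has a linear representation. -/
def NCRatExpr.linearization : (p : NCRatExpr F m) → Linearization p
  | .const c => .const c
  | .var k => .var k
  | .add p q => .add p.linearization q.linearization
  | .mul p q => .mul p.linearization q.linearization
  | .inv p => .inv p.linearization

/-- The pencil of the homogenizing variable. -/
lemma isFullPencil_homVar : IsFullPencil (constPencil (m := m) (1 : Matrix Unit Unit F)) := by
  refine IsNonsing.isFullPencil (D := F) (x := homPoint 0) ?_
  rw [pencil_constPencil, Matrix.map_one _ (map_zero _) (map_one _)]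
  exact fun v => ⟨v, Matrix.one_mulVec v⟩

lemma IsNonsing.pencil_smul {K : Type*} [DivisionRing K] [Algebra F K]
    {A : Option (Fin m) → Matrix ι ι F} {x : Option (Fin m) → K} (h : IsNonsing (pencil A x))
    {c : K} (hc : c ≠ 0) : IsNonsing (pencil A fun o => c * x o) := by
  intro w
  obtain ⟨y, hy⟩ := h (c⁻¹ • w)
  refine ⟨y, ?_⟩
  have h1 : (pencil A fun o => c * x o) = c • pencil A x := by
    ext i j
    simp [pencil, Finset.mul_sum, mul_assoc, mul_add]
  rw [h1, Matrix.smul_mulVec, hy, smul_inv_smul₀ hc]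

/-- Rational expressions that are defined somewhere are defined simultaneously. -/
theorem exists_definedAt_mul {p q : NCRatExpr F m}
    (hp : ∃ (K : Type u) (_ : DivisionRing K) (_ : Algebra F K) (a : Fin m → K), p.DefinedAt a)
    (hq : ∃ (K : Type u) (_ : DivisionRing K) (_ : Algebra F K) (a : Fin m → K), q.DefinedAt a) :
    ∃ (K : Type u) (_ : DivisionRing K) (_ : Algebra F K) (a : Fin m → K),
      (NCRatExpr.mul p q).DefinedAt a := by
  have hfull : ∀ p : NCRatExpr F m, (∃ (K : Type u) (_ : DivisionRing K) (_ : Algebra F K)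
      (a : Fin m → K), p.DefinedAt a) → IsFullPencil p.linearization.L := by
    rintro p ⟨K, _, _, a, hp⟩
    exact ((p.linearization.definedAt_iff K a).1 hp).isFullPencil
  -- The extra `1 × 1` summand is the homogenizing variable itself, so it is nonzero at the point
  -- found. Scaling on the left by its inverse returns to affine coordinates.
  obtain ⟨K, _, _, a, h⟩ :=
    ((hfull p hp).sum ((hfull q hq).sum isFullPencil_homVar)).exists_isNonsing
  rw [isNonsing_pencilSum, isNonsing_pencilSum] at h
  obtain ⟨h1, h2, h3⟩ := h
  have h0 : a none ≠ 0 := by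
    intro h0
    obtain ⟨y, hy⟩ := h3 1
    have := congrFun hy ()
    simp [Matrix.mulVec, dotProduct, pencil, constPencil, Fintype.sum_option, h0] at this
  have hhom : (fun o => (a none)⁻¹ * a o) = homPoint fun k => (a none)⁻¹ * a (some k) := by
    ext o
    cases o with
    | none => exact inv_mul_cancel₀ h0
    | some k => rfl
  have h1' := h1.pencil_smul (inv_ne_zero h0)
  have h2' := h2.pencil_smul (inv_ne_zero h0)
  rw [hhom] at h1' h2'
  exact ⟨K, inferInstance, inferInstance, _, (p.linearization.definedAt_iff K _).2 h1',
    (q.linearization.definedAt_iff K _).2 h2'⟩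

end Linearization

/-! ### Existence of the free skew field -/

section Existence

variable {F : Type u} [Field F] {m : ℕ}

/-- Finitely many rational expressions, each defined somewhere, are defined simultaneously. -/
lemma exists_definedAt_finset (s : Finset {p : NCRatExpr F m // ∃ (K : Type u) (_ : DivisionRing K)
    (_ : Algebra F K) (a : Fin m → K), p.DefinedAt a}) :
    ∃ (K : Type u) (_ : DivisionRing K) (_ : Algebra F K) (a : Fin m → K),
      ∀ p ∈ s, p.1.DefinedAt a := by
  classical
  -- The induction carries a single product expression whose definedness forces that of every member
  -- of the finite set.
  suffices h : ∃ q : NCRatExpr F m, (∃ (K : Type u) (_ : DivisionRing K) (_ : Algebra F K)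
      (a : Fin m → K), q.DefinedAt a) ∧ ∀ (K : Type u) [DivisionRing K] [Algebra F K]
      (a : Fin m → K), q.DefinedAt a → ∀ p ∈ s, p.1.DefinedAt a by
    obtain ⟨q, ⟨K, _, _, a, hq⟩, h⟩ := h
    exact ⟨K, inferInstance, inferInstance, a, h K a hq⟩
  induction s using Finset.induction_on with
  | empty => exact ⟨.const 0, ⟨F, inferInstance, inferInstance, 0, trivial⟩, by simp⟩
  | insert p s _ ih =>
    obtain ⟨q, hq, h⟩ := ih
    refine ⟨.mul p.1 q, exists_definedAt_mul p.2 hq, fun K _ _ a hpq p' hp' => ?_⟩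
    rcases Finset.mem_insert.1 hp' with rfl | hp'
    · exact hpq.1
    · exact h K a hpq.2 p' hp'

lemma NCRatExpr.eval_map {K K' : Type u} [DivisionRing K] [Algebra F K] [DivisionRing K']
    [Algebra F K'] (f : K →ₐ[F] K') (a : Fin m → K) (p : NCRatExpr F m) :
    p.eval (fun k => f (a k)) = f (p.eval a) := by
  induction p with
  | const c => simp [eval]
  | var k => rfl
  | add p q hp hq => simp [eval, hp, hq]
  | mul p q hp hq => simp [eval, hp, hq]
  | inv p hp => simp [eval, hp]

lemma NCRatExpr.definedAt_map {K K' : Type u} [DivisionRing K] [Algebra F K] [DivisionRing K']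
    [Algebra F K'] (f : K →ₐ[F] K') (a : Fin m → K) (p : NCRatExpr F m) :
    p.DefinedAt (fun k => f (a k)) ↔ p.DefinedAt a := by
  induction p with
  | const c => rfl
  | var k => rfl
  | add p q hp hq => exact and_congr hp hq
  | mul p q hp hq => exact and_congr hp hq
  | inv p hp =>
    refine and_congr hp ?_
    rw [NCRatExpr.eval_map, Ne, Ne, map_eq_zero]

section Ultraproduct

variable {I : Type u} (U : Ultrafilter I) (K : I → Type u) [∀ s, DivisionRing (K s)]

/-- Equality along an ultrafilter. -/
def ultraCon : RingCon (∀ s, K s) where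
  r f g := ∀ᶠ s in U, f s = g s
  iseqv := ⟨fun _ => Filter.Eventually.of_forall fun _ => rfl, fun h => h.mono fun _ => Eq.symm,
    fun h h' => h.mp (h'.mono fun _ h1 h2 => h2.trans h1)⟩
  add' h h' := h.mp (h'.mono fun s h1 h2 => by rw [Pi.add_apply, Pi.add_apply, h1, h2])
  mul' h h' := h.mp (h'.mono fun s h1 h2 => by rw [Pi.mul_apply, Pi.mul_apply, h1, h2])

/-- The ultraproduct of a family of division rings. -/
abbrev Ultraproduct : Type u := (ultraCon U K).Quotient

variable {U K}

lemma ultra_eq_iff {f g : ∀ s, K s} :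
    ((f : Ultraproduct U K) = (g : Ultraproduct U K)) ↔ ∀ᶠ s in U, f s = g s :=
  (ultraCon U K).eq

lemma ultra_mul_inv {f : ∀ s, K s} (h : (f : Ultraproduct U K) ≠ 0) :
    (f : Ultraproduct U K) * ((f⁻¹ : ∀ s, K s) : Ultraproduct U K) = 1 := by
  have h1 : ¬ ∀ᶠ s in U, f s = (0 : ∀ s, K s) s := fun h' => h (ultra_eq_iff.2 h')
  rw [← Ultrafilter.eventually_not] at h1
  rw [← RingCon.coe_mul, ← RingCon.coe_one, ultra_eq_iff]
  exact h1.mono fun s hs => mul_inv_cancel₀ hs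

lemma ultra_inv_mul {f : ∀ s, K s} (h : (f : Ultraproduct U K) ≠ 0) :
    ((f⁻¹ : ∀ s, K s) : Ultraproduct U K) * (f : Ultraproduct U K) = 1 := by
  have h1 : ¬ ∀ᶠ s in U, f s = (0 : ∀ s, K s) s := fun h' => h (ultra_eq_iff.2 h')
  rw [← Ultrafilter.eventually_not] at h1
  rw [← RingCon.coe_mul, ← RingCon.coe_one, ultra_eq_iff]
  exact h1.mono fun s hs => inv_mul_cancel₀ hs

instance : Nontrivial (Ultraproduct U K) where
  exists_pair_ne := ⟨0, 1, fun h => by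
    rw [← RingCon.coe_zero, ← RingCon.coe_one, ultra_eq_iff] at h
    obtain ⟨s, hs⟩ := h.exists
    exact zero_ne_one hs⟩

noncomputable instance : DivisionRing (Ultraproduct U K) :=
  DivisionRing.ofIsUnitOrEqZero fun z => by
    induction z using Quotient.inductionOn' with
    | h f =>
      by_cases h : (f : Ultraproduct U K) = 0
      · exact Or.inr h
      · exact Or.inl ⟨⟨f, (f⁻¹ : ∀ s, K s), ultra_mul_inv h, ultra_inv_mul h⟩, rfl⟩

lemma ultra_inv (f : ∀ s, K s) :
    ((f⁻¹ : ∀ s, K s) : Ultraproduct U K) = (f : Ultraproduct U K)⁻¹ := by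
  by_cases h : (f : Ultraproduct U K) = 0
  · rw [h, inv_zero, ← RingCon.coe_zero, ultra_eq_iff]
    rw [← RingCon.coe_zero, ultra_eq_iff] at h
    exact h.mono fun s hs => by rw [Pi.inv_apply, hs, Pi.zero_apply, inv_zero]
  · exact eq_inv_of_mul_eq_one_right (ultra_mul_inv h)

variable [∀ s, Algebra F (K s)] (a : ∀ s, Fin m → K s)

/-- Łoś's theorem for values. The convention that zero has inverse zero holds in the factors and in
the ultraproduct, so definedness plays no role. -/
lemma ultra_eval (p : NCRatExpr F m) :
    p.eval (fun k => ((fun s => a s k : ∀ s, K s) : Ultraproduct U K)) =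
      ((fun s => p.eval (a s) : ∀ s, K s) : Ultraproduct U K) := by
  induction p with
  | const c => rfl
  | var k => rfl
  | add p q hp hq => rw [NCRatExpr.eval, hp, hq]; rfl
  | mul p q hp hq => rw [NCRatExpr.eval, hp, hq]; rfl
  | inv p hp => rw [NCRatExpr.eval, hp, ← ultra_inv]; rfl

lemma ultra_definedAt {p : NCRatExpr F m} (h : ∀ᶠ s in U, p.DefinedAt (a s)) :
    p.DefinedAt (fun k => ((fun s => a s k : ∀ s, K s) : Ultraproduct U K)) := by
  induction p with
  | const c => trivial
  | var k => trivial
  | add p q hp hq => exact ⟨hp (h.mono fun _ h => h.1), hq (h.mono fun _ h => h.2)⟩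
  | mul p q hp hq => exact ⟨hp (h.mono fun _ h => h.1), hq (h.mono fun _ h => h.2)⟩
  | inv p hp =>
    refine ⟨hp (h.mono fun _ h => h.1), fun h0 => ?_⟩
    rw [ultra_eval, ← RingCon.coe_zero, ultra_eq_iff] at h0
    obtain ⟨s, h1, h2⟩ := (h.and h0).exists
    exact h1.2 h2

end Ultraproduct

/-- The skew subfield generated by a point. -/
def generatedSubfield {K : Type u} [DivisionRing K] [Algebra F K] (a : Fin m → K) : Subfield K where
  carrier := {z | ∃ p : NCRatExpr F m, p.DefinedAt a ∧ p.eval a = z}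
  mul_mem' := by
    rintro _ _ ⟨p, hp, rfl⟩ ⟨q, hq, rfl⟩
    exact ⟨.mul p q, ⟨hp, hq⟩, rfl⟩
  one_mem' := ⟨.const 1, trivial, map_one _⟩
  add_mem' := by
    rintro _ _ ⟨p, hp, rfl⟩ ⟨q, hq, rfl⟩
    exact ⟨.add p q, ⟨hp, hq⟩, rfl⟩
  zero_mem' := ⟨.const 0, trivial, map_zero _⟩
  neg_mem' := by
    rintro _ ⟨p, hp, rfl⟩
    exact ⟨.mul (.const (-1)) p, ⟨trivial, hp⟩, by simp [NCRatExpr.eval]⟩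
  inv_mem' := by
    rintro _ ⟨p, hp, rfl⟩
    by_cases h : p.eval a = 0
    · exact ⟨.const 0, trivial, by rw [h, inv_zero]; exact map_zero _⟩
    · exact ⟨.inv p, ⟨hp, h⟩, rfl⟩

/-- The free skew field exists. -/
theorem exists_isFreeSkewField (F : Type u) [Field F] (m : ℕ) :
    ∃ (D : Type u) (_ : DivisionRing D) (_ : Algebra F D) (x : Fin m → D),
      IsFreeSkewField F x := by
  classical
  let P := {p : NCRatExpr F m // ∃ (K : Type u) (_ : DivisionRing K) (_ : Algebra F K)
    (a : Fin m → K), p.DefinedAt a}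
  choose K i1 i2 a ha using exists_definedAt_finset (F := F) (m := m)
  -- Refining `atTop`, so that each expression is defined at `a s` for almost all finite sets `s`,
  -- namely those that contain it.
  let U : Ultrafilter (Finset P) := Ultrafilter.of Filter.atTop
  let y : Fin m → Ultraproduct U K := fun k => ((fun s => a s k : ∀ s, K s) : Ultraproduct U K)
  have hy : ∀ p : P, p.1.DefinedAt y := by
    intro p
    apply ultra_definedAt
    have h := Filter.eventually_ge_atTop ({p} : Finset P)
    exact (h.filter_mono (Ultrafilter.of_le Filter.atTop)).mono fun s hs =>
      ha s p (hs (Finset.mem_singleton_self p))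
  let S := generatedSubfield (F := F) y
  let _ : Algebra F S := RingHom.toAlgebra'
    ((algebraMap F (Ultraproduct U K)).codRestrict S fun c => ⟨.const c, trivial, rfl⟩)
    fun c z => Subtype.ext (Algebra.commutes c z.1)
  let f : S →ₐ[F] Ultraproduct U K := { S.subtype with commutes' := fun _ => rfl }
  let x : Fin m → S := fun k => ⟨y k, .var k, trivial, rfl⟩
  refine ⟨S, inferInstance, inferInstance, x, ?_, ?_⟩
  · rintro ⟨z, p, hp, hz⟩
    refine ⟨p, (NCRatExpr.definedAt_map f x p).1 hp, Subtype.ext ?_⟩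
    exact (NCRatExpr.eval_map f x p).symm.trans hz
  · intro K _ _ b p hp
    exact (NCRatExpr.definedAt_map f x p).1 (hy ⟨p, K, inferInstance, inferInstance, b, hp⟩)

end Existence

/-! ### Ranks at generic points -/

section Transfer

open Matrix

variable {D : Type*} [DivisionRing D] {ι κ : Type*} [Fintype ι] [Fintype κ]

/-- Elimination of the row `i₀` and the column `j₀`. -/
def schurComplement (N : Matrix ι κ D) (i₀ : ι) (j₀ : κ) : Matrix ι κ D :=
  fun i j => N i j - N i j₀ * (N i₀ j₀)⁻¹ * N i₀ j

/-- Elimination changes rows by left multiples of the pivot row. The new rows vanish in column `j₀`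
and the pivot row does not, so the row space loses exactly one dimension. -/
lemma rowRank_schurComplement (N : Matrix ι κ D) {i₀ : ι} {j₀ : κ} (h : N i₀ j₀ ≠ 0) :
    rowRank N = rowRank (schurComplement N i₀ j₀) + 1 := by
  classical
  have hrow : ∀ i, N.row i = (schurComplement N i₀ j₀).row i + (N i j₀ * (N i₀ j₀)⁻¹) • N.row i₀ := by
    intro i
    ext j
    simp [schurComplement, Matrix.row]
  set V := Submodule.span D (Set.range N.row) with hV
  set W := Submodule.span D (Set.range (schurComplement N i₀ j₀).row) with hW
  have h0 : N.row i₀ ∈ V := Submodule.subset_span ⟨i₀, rfl⟩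
  have hWV : W ≤ V := by
    rw [hW, Submodule.span_le]
    rintro _ ⟨i, rfl⟩
    rw [← sub_eq_of_eq_add (hrow i)]
    exact V.sub_mem (Submodule.subset_span ⟨i, rfl⟩) (V.smul_mem _ h0)
  have hW0 : ∀ w ∈ W, w j₀ = 0 := by
    have : W ≤ LinearMap.ker (LinearMap.proj (R := D) (φ := fun _ : κ => D) j₀) := by
      rw [hW, Submodule.span_le]
      rintro _ ⟨i, rfl⟩
      change N i j₀ - N i j₀ * (N i₀ j₀)⁻¹ * N i₀ j₀ = 0
      rw [mul_assoc, inv_mul_cancel₀ h, mul_one, sub_self]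
    exact fun w hw => this hw
  have hlt : W < V := lt_of_le_of_ne hWV fun heq => h (hW0 _ (heq ▸ h0))
  have hVW : V ≤ W ⊔ Submodule.span D {N.row i₀} := by
    rw [hV, Submodule.span_le]
    rintro _ ⟨i, rfl⟩
    rw [hrow i]
    exact Submodule.add_mem_sup (Submodule.subset_span ⟨i, rfl⟩)
      (Submodule.smul_mem _ _ (Submodule.mem_span_singleton_self _))
  have h1 := Submodule.finrank_lt_finrank_of_lt hlt
  have h2 := (Submodule.finrank_mono hVW).trans (Submodule.finrank_add_le_finrank_add_finrank _ _)
  have h3 : Module.finrank D (Submodule.span D {N.row i₀}) ≤ 1 := by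
    simpa using finrank_span_le_card (R := D) ({N.row i₀} : Set (κ → D))
  change Module.finrank D V = Module.finrank D W + 1
  omega

variable {F : Type u} [Field F] {m : ℕ}

/-- The rank of a matrix of rational expressions does not drop at a point where more expressions
are defined. -/
theorem rowRank_eval_le {K L : Type u} [DivisionRing K] [Algebra F K] [DivisionRing L]
    [Algebra F L] {a : Fin m → K} {x : Fin m → L}
    (h : ∀ p : NCRatExpr F m, p.DefinedAt a → p.DefinedAt x) (M : Matrix ι κ (NCRatExpr F m))
    (hM : ∀ i j, (M i j).DefinedAt a) :
    rowRank (M.map fun p => p.eval a) ≤ rowRank (M.map fun p => p.eval x) := by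
  generalize hr : rowRank (M.map fun p => p.eval a) = r
  induction r generalizing M with
  | zero => exact Nat.zero_le _
  | succ r ih =>
    obtain ⟨i₀, j₀, h0⟩ : ∃ i₀ j₀, (M i₀ j₀).eval a ≠ 0 := by
      by_contra! h0
      have : (M.map fun p => p.eval a) = (0 : Matrix ι Unit K) * (0 : Matrix Unit κ K) := by
        ext i j
        simp [h0]
      rw [this] at hr
      have h1 := rowRank_mul_le_left (0 : Matrix ι Unit K) (0 : Matrix Unit κ K)
      have h2 : rowRank (0 : Matrix ι Unit K) = 0 := by
        rw [rowRank_eq_finrank_range]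
        have : (0 : Matrix ι Unit K).vecMulLinear = 0 := by
          ext; simp
        rw [this, LinearMap.range_zero, finrank_bot]
      omega
    -- The Schur complement written with formal expressions. The inverse of the pivot is defined at
    -- `a`, hence at `x`, so the same pivot is nonzero at both points.
    let M' : Matrix ι κ (NCRatExpr F m) := Matrix.of fun i j =>
      .add (M i j) (.mul (.const (-1)) (.mul (.mul (M i j₀) (.inv (M i₀ j₀))) (M i₀ j)))
    have hM' : ∀ i j, (M' i j).DefinedAt a := fun i j =>
      ⟨hM i j, trivial, ⟨hM i j₀, hM i₀ j₀, h0⟩, hM i₀ j⟩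
    have h0' : (M i₀ j₀).eval x ≠ 0 := (h (.inv (M i₀ j₀)) ⟨hM i₀ j₀, h0⟩).2
    have ha : (M'.map fun p => p.eval a) = schurComplement (M.map fun p => p.eval a) i₀ j₀ := by
      ext i j
      simp [M', NCRatExpr.eval, schurComplement, sub_eq_add_neg]
    have hx : (M'.map fun p => p.eval x) = schurComplement (M.map fun p => p.eval x) i₀ j₀ := by
      ext i j
      simp [M', NCRatExpr.eval, schurComplement, sub_eq_add_neg]
    rw [rowRank_schurComplement (M.map fun p => p.eval a) (i₀ := i₀) (j₀ := j₀) h0, ← ha] at hr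
    rw [rowRank_schurComplement (M.map fun p => p.eval x) (i₀ := i₀) (j₀ := j₀) h0', ← hx]
    have := ih M' hM' (by omega)
    omega

/-- The sum of a family of rational expressions. -/
def NCRatExpr.sum (f : Fin m → NCRatExpr F m) : NCRatExpr F m :=
  (List.finRange m).foldr (fun k e => .add (f k) e) (.const 0)

lemma NCRatExpr.eval_sum {K : Type u} [DivisionRing K] [Algebra F K] (a : Fin m → K)
    (f : Fin m → NCRatExpr F m) : (NCRatExpr.sum f).eval a = ∑ k, (f k).eval a := by
  rw [Fin.sum_univ_def, NCRatExpr.sum]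
  induction List.finRange m with
  | nil => simp [eval]
  | cons k l ih => simp [eval, ih]

lemma NCRatExpr.definedAt_sum {K : Type u} [DivisionRing K] [Algebra F K] {a : Fin m → K}
    {f : Fin m → NCRatExpr F m} (h : ∀ k, (f k).DefinedAt a) : (NCRatExpr.sum f).DefinedAt a := by
  rw [NCRatExpr.sum]
  induction List.finRange m with
  | nil => trivial
  | cons k l ih => exact ⟨h k, ih⟩

lemma rowRank_pencil_le {K L : Type u} [DivisionRing K] [Algebra F K] [DivisionRing L]
    [Algebra F L] {a : Fin m → K} {x : Fin m → L}
    (h : ∀ p : NCRatExpr F m, p.DefinedAt a → p.DefinedAt x) (A : Fin m → Matrix ι κ F) :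
    rowRank (pencil A a) ≤ rowRank (pencil A x) := by
  let M : Matrix ι κ (NCRatExpr F m) := fun i j =>
    NCRatExpr.sum fun k => .mul (.var k) (.const (A k i j))
  have hM : ∀ (K : Type u) [DivisionRing K] [Algebra F K] (a : Fin m → K),
      (M.map fun p => p.eval a) = pencil A a := by
    intro K _ _ a
    ext i j
    exact NCRatExpr.eval_sum a _
  rw [← hM, ← hM]
  exact rowRank_eval_le h M fun i j => NCRatExpr.definedAt_sum fun k => ⟨trivial, trivial⟩

end Transfer

lemma quiverWeight_kroneckerWeight {m : ℕ} (α : KroneckerQuiver m → ℕ) :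
    quiverWeight (kroneckerWeight m) α = (α .source : ℤ) - α .target := by
  have h : (Finset.univ : Finset (KroneckerQuiver m)) = {.source, .target} := by
    ext v
    cases v <;> simp
  rw [quiverWeight, h, Finset.sum_pair (by simp)]
  simp [kroneckerWeight, sub_eq_add_neg]

theorem mainTheorem9 {F : Type u} [Field F] {m n : ℕ}
    (A : Fin m → Matrix (Fin n) (Fin n) F) :
    -- the free skew field on `m` variables over `F` exists
    (∃ (D : Type u) (_ : DivisionRing D) (_ : Algebra F D) (x : Fin m → D),
      IsFreeSkewField F x) ∧
    -- the maximum `c` exists, and the rank over the free skew field is `n - c`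
    ∃ c : ℤ,
      IsGreatest {s : ℤ | ∃ W' : QuiverSubrep (kroneckerRep A),
        s = quiverWeight (kroneckerWeight m) W'.dimVec} c ∧
      ∀ (D : Type u) [DivisionRing D] [Algebra F D] (x : Fin m → D),
        IsFreeSkewField F x → (skewRank (linearMatrix A x) : ℤ) = (n : ℤ) - c := by
  refine ⟨exists_isFreeSkewField F m, ?_⟩
  -- The rank at `a` mediates: the upper bound at `a` shows that no subspace shrinks by more than
  -- `U`, and the rank at the generic point lies between the rank at `a` and the bound given by `U`.
  obtain ⟨K, _, _, a, U, hU⟩ := exists_point_and_shrunk_subspace A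
  rw [Fintype.card_fin] at hU
  refine ⟨(Module.finrank F U : ℤ) - Module.finrank F (pencilImage A U), ⟨?_, ?_⟩, ?_⟩
  · let W' : QuiverSubrep (kroneckerRep A) :=
      { space := fun v => match v with
          | .source => U
          | .target => pencilImage A U
        map_mem := fun {v w} => match v, w with
          | .source, .target => fun k _ hz => mulVec_mem_pencilImage (A := A) k hz
          | .source, .source => fun e => Empty.elim e
          | .target, .source => fun e => Empty.elim e
          | .target, .target => fun e => Empty.elim e }
    refine ⟨W', ?_⟩
    rw [quiverWeight_kroneckerWeight]
    rfl
  · rintro _ ⟨W', rfl⟩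
    rw [quiverWeight_kroneckerWeight]
    let S : Submodule F (Fin n → F) := W'.space .source
    let T : Submodule F (Fin n → F) := W'.space .target
    have h1 := finrank_add_rowRank_pencil_le A a S
    have h2 : pencilImage A S ≤ T := pencilImage_le.2 fun k z hz =>
      W'.map_mem (v := .source) (w := .target) k z hz
    have h3 := Submodule.finrank_mono h2
    rw [Fintype.card_fin] at h1
    change ((Module.finrank F S : ℕ) : ℤ) - (Module.finrank F T : ℕ) ≤ _
    omega
  · intro D _ _ x hx
    have h1 := finrank_add_rowRank_pencil_le A x U
    have h2 := rowRank_pencil_le (hx.universal K a) A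
    rw [Fintype.card_fin] at h1
    change ((rowRank (pencil A x) : ℕ) : ℤ) = _
    omega
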